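/- Let $1\le d<n$ be integers, let $\Omega\subset\mathbb R^n$ be open, and let $G_{d,n}$ be the Grassmannian of $d$-dimensional linear subspaces of $\mathbb R^n$ (a subspace is identified with the orthogonal projection onto it, with the operator norm distance). *Kernels.* Let $\rho\in C^1(\mathbb R)$ and $\xi\in C^0(\mathbb R)$ be even, non-negative, supported in $[-1,1]$, with $\int_{\mathbb R^n}\rho(|x|)\,dx=\int_{\mathbb R^n}\xi(|x|)\,dx=1$. For $\epsilon>0$ put $\rho_\epsilon(x)=\epsilon^{-n}\rho(|x|/\epsilon)$, $\xi_\epsilon(x)=\epsilon^{-n}\xi(|x|/\epsilon)$, and $$C_\rho=d\,\omega_d\int_0^1\rho(r)r^{d-1}\,dr,\qquad C_\xi=d\,\omega_d\int_0^1\xi(r)r^{d-1}\,dr,$$ where $\omega_d$ is the volume of the unit ball of $\mathbb R^d$. *Varifolds.* A $d$-varifold in $\Omega$ is a non-negative Radon measure $V$ on $\Omega\times G_{d,n}$; its mass $\|V\|$ is the push-forward of $V$ to $\Omega$. It is the rectifiable varifold $v(M,\theta)$ if $M\subset\mathbb R^n$ is an $\mathcal H^d$-measurable set covered, up to an $\mathcal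 H^d$-null set, by countably many Lipschitz images of $\mathbb R^d$, $\theta\ge0$ is locally $\mathcal H^d|_M$-integrable in $\Omega$ with $\theta>0$ $\mathcal H^d$-a.e. on $M$, and $$\int\varphi\,dV=\int_M\varphi(x,T_xM)\,\theta(x)\,d\mathcal H^d(x)\qquad\text{for all }\varphi\in C^0_c(\Omega\times G_{d,n}),$$ where $T_xM$ is the approximate tangent space of $M$ at $x$, i.e. $\theta(x)>0$ and $r^{-d}\int_M f((y-x)/r)\,\theta(y)\,d\mathcal H^d(y)\to\theta(x)\int_{T_xM}f\,d\mathcal H^d$ as $r\to0^+$ for all $f\in C^0_c(\mathbb R^n)$ (it exists for $\mathcal H^d$-a.e. $x\in M\cap\Omega$). *First variation.* For a $C^1$ vector field $X=(X_1,\dots,X_n)$ let $\operatorname{div}_PX=\sum_j\langle P\nabla X_j,e_j\rangle$ and $\delta V(X)=\int\operatorname{div}_PX(x)\,dV(x,P)$. $V$ has locally bounded first variation in $\Omega$ if for every compact $K\subset\Omega$ there is $c_K$ with $|\delta V(X)|\le c_K\sup_K|X|$ for all $X\in C^1_c(\Omega,\mathbb R^n)$ with support in $K$. A function $H\in L^1_{loc}(\Omega,\|V\|)^n$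 is a generalized mean curvature vector of $V$ if, on $C^1_c(\Omega,\mathbb R^n)$, $\delta V=-H\|V\|+\delta V_s$ for some $\mathbb R^n$-valued Radon measure $\delta V_s$ on $\Omega$ that is singular with respect to $\|V\|$. *Approximate mean curvature.* Let $(\delta V*\rho_\epsilon)(x)=\big(\delta V(\rho_\epsilon(x-\cdot)e_i)\big)_{i=1}^n$ and $(\|V\|*\xi_\epsilon)(x)=\int\xi_\epsilon(x-y)\,d\|V\|(y)$, and, when $(\|V\|*\xi_\epsilon)(x)>0$, $$H^V_{\rho,\xi,\epsilon}(x)=-\frac{C_\xi}{C_\rho}\,\frac{(\delta V*\rho_\epsilon)(x)}{(\|V\|*\xi_\epsilon)(x)}.$$ **Theorem.** Let $V=v(M,\theta)$ be a rectifiable $d$-varifold with locally bounded first variation in $\Omega$. Then $V$ has a generalized mean curvature vector, and for every generalized mean curvature vector $H$ of $V$ and for $\|V\|$-almost every $x\in\Omega$, one has $(\|V\|*\xi_\epsilon)(x)>0$ for all sufficiently small $\epsilon>0$, and $$H^V_{\rho,\xi,\epsilon}(x)\longrightarrow H(x)\qquad\text{as }\epsilon\to0^+.$$ -/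

import Mathlib

open MeasureTheory Filter Topology Set
open scoped Gradient RealInnerProductSpace

/-- Euclidean `n`-space. -/
abbrev Euc (n : ℕ) : Type := EuclideanSpace ℝ (Fin n)

/-- The Grassmannian of `d`-dimensional vector subspaces of `ℝⁿ`, a subspace being identified
with the orthogonal projection onto it. The subtype metric is the operator norm distance of the
projections, and the measurable structure is the Borel one. -/
abbrev Grass (d n : ℕ) : Type :=
  {P : Euc n →L[ℝ] Euc n // IsStarProjection P ∧ Module.finrank ℝ (LinearMap.range P.toLinearMap) = d}

/-- The subspace of `ℝⁿ` corresponding to an element of the Grassmannian. -/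
def Grass.toSet {d n : ℕ} (P : Grass d n) : Set (Euc n) := range (P : Euc n →L[ℝ] Euc n)

/-- A `d`-varifold in the open set `Ω`: a non-negative Radon measure on `Ω × G_{d,n}`. It is
represented by a Borel measure on `ℝⁿ × G_{d,n}` that is carried by `Ω × G_{d,n}` and is finite on
`K × G_{d,n}` for all compact `K ⊆ Ω` (the Grassmannian is compact, and the space is a locally
compact separable metric space, so that regularity is automatic). -/
structure IsVarifold {d n : ℕ} (Ω : Set (Euc n)) (V : Measure (Euc n × Grass d n)) : Prop where
  carried : V (Ω ×ˢ univ)ᶜ = 0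
  finite_on_compacts : ∀ K : Set (Euc n), IsCompact K → K ⊆ Ω → V (K ×ˢ univ) < ⊤

/-- The mass `‖V‖`, the push-forward of `V` under `(x, S) ↦ x`. -/
noncomputable def varifoldMass {d n : ℕ} (V : Measure (Euc n × Grass d n)) : Measure (Euc n) :=
  V.map Prod.fst

/-- Countably `d`-rectifiable (and `ℋᵈ`-measurable) sets: up to an `ℋᵈ`-null set, `M` is covered
by countably many Lipschitz images of `ℝᵈ`. -/
structure IsCountablyRectifiable {n : ℕ} (d : ℕ) (M : Set (Euc n)) : Prop where
  nullMeasurable : NullMeasurableSet M (μHE[d] : Measure (Euc n))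
  covered : ∃ f : ℕ → Euc d → Euc n, (∀ i, ∃ L, LipschitzWith L (f i)) ∧
    (μHE[d] : Measure (Euc n)) (M \ ⋃ i, range (f i)) = 0

/-- `P` is the approximate tangent space at `x` of `M` (with multiplicity `θ`): the measures
obtained from `θ ℋᵈ|_M` by blowing up at `x` converge to `θ(x) ℋᵈ|_P`, where `θ(x) > 0`. -/
def IsApproxTangentSpace {d n : ℕ} (M : Set (Euc n)) (θ : Euc n → ℝ) (x : Euc n)
    (P : Grass d n) : Prop :=
  0 < θ x ∧ ∀ f : Euc n → ℝ, Continuous f → HasCompactSupport f →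
    Tendsto (fun r : ℝ => (r ^ d)⁻¹ * ∫ y in M, f (r⁻¹ • (y - x)) * θ y ∂μHE[d])
      (𝓝[>] 0) (𝓝 (θ x * ∫ y in P.toSet, f y ∂μHE[d]))

/-- `V` is the rectifiable `d`-varifold `v(M, θ) = θ ℋᵈ|_M ⊗ δ_{T_x M}` in `Ω`. The map `T` gives
the approximate tangent space `T_x M` at each point of `M ∩ Ω` where there is one, that is, at
`ℋᵈ`-almost every point; its values at the other points do not matter. -/
structure IsRectifiableVarifold {d n : ℕ} (Ω M : Set (Euc n)) (θ : Euc n → ℝ)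
    (V : Measure (Euc n × Grass d n)) : Prop where
  isVarifold : IsVarifold Ω V
  rectifiable : IsCountablyRectifiable d M
  nonneg : ∀ x, 0 ≤ θ x
  pos : ∀ᵐ x ∂(μHE[d] : Measure (Euc n)).restrict M, 0 < θ x
  locallyIntegrable : ∀ K : Set (Euc n), IsCompact K → K ⊆ Ω → IntegrableOn θ (M ∩ K) μHE[d]
  eq_integral : ∃ T : Euc n → Grass d n,
    (∀ x ∈ M ∩ Ω, ∀ P : Grass d n, IsApproxTangentSpace M θ x P → T x = P) ∧
    ∀ φ : Euc n × Grass d n → ℝ, Continuous φ → HasCompactSupport φ → tsupport φ ⊆ Ω ×ˢ univ →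
      ∫ p, φ p ∂V = ∫ x in M, φ (x, T x) * θ x ∂μHE[d]

/-- The tangential divergence `div_P X (x) = ∑ⱼ ⟨P (∇ Xⱼ (x)), eⱼ⟩`. -/
noncomputable def tangentialDiv {d n : ℕ} (P : Grass d n) (X : Euc n → Euc n) (x : Euc n) : ℝ :=
  ∑ j : Fin n, ⟪(P : Euc n →L[ℝ] Euc n) (∇ (fun y => X y j) x), EuclideanSpace.single j (1 : ℝ)⟫

/-- The first variation `δV(X) = ∫ div_P X (x) dV(x, P)`. -/
noncomputable def firstVariation {d n : ℕ} (V : Measure (Euc n × Grass d n))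
    (X : Euc n → Euc n) : ℝ :=
  ∫ p, tangentialDiv p.2 X p.1 ∂V

/-- The space `C¹_c(Ω, ℝⁿ)` of test vector fields. -/
structure IsTestField {n : ℕ} (Ω : Set (Euc n)) (X : Euc n → Euc n) : Prop where
  contDiff : ContDiff ℝ 1 X
  hasCompactSupport : HasCompactSupport X
  tsupport_subset : tsupport X ⊆ Ω

/-- Locally bounded first variation: for all compact `K ⊆ Ω` there is `c_K` such that
`|δV(X)| ≤ c_K sup_K |X|` for all `X ∈ C¹_c(Ω, ℝⁿ)` with support in `K`. -/
def HasLocallyBoundedFirstVariation {d n : ℕ} (Ω : Set (Euc n))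
    (V : Measure (Euc n × Grass d n)) : Prop :=
  ∀ K : Set (Euc n), IsCompact K → K ⊆ Ω → ∃ c : ℝ, ∀ X : Euc n → Euc n,
    IsTestField Ω X → tsupport X ⊆ K → |firstVariation V X| ≤ c * ⨆ x : K, ‖X x‖

/-- `H` is a generalized mean curvature vector of `V`: `H ∈ L¹_loc(Ω, ‖V‖)ⁿ` and
`δV = -H ‖V‖ + δV_s` on `Ω`, where the vector-valued Radon measure `δV_s` is singular with respect
to `‖V‖`. Here `δV_s` is written as `σ ν` with `ν` a non-negative Radon measure on `Ω`, singular
with respect to `‖V‖`, and `σ ∈ L¹_loc(Ω, ν)ⁿ`. -/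
def IsGeneralizedMeanCurvature {d n : ℕ} (Ω : Set (Euc n)) (V : Measure (Euc n × Grass d n))
    (H : Euc n → Euc n) : Prop :=
  (∀ K : Set (Euc n), IsCompact K → K ⊆ Ω → IntegrableOn H K (varifoldMass V)) ∧
  ∃ (ν : Measure (Euc n)) (σ : Euc n → Euc n),
    ν Ωᶜ = 0 ∧
    (∀ K : Set (Euc n), IsCompact K → K ⊆ Ω → ν K < ⊤ ∧ IntegrableOn σ K ν) ∧
    ν ⟂ₘ varifoldMass V ∧
    ∀ X : Euc n → Euc n, IsTestField Ω X →
      firstVariation V X = -∫ x, ⟪X x, H x⟫ ∂(varifoldMass V) + ∫ x, ⟪X x, σ x⟫ ∂ν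

/-- Kernel profiles on `ℝ`: even, non-negative, supported in `[-1, 1]`, and such that the radial
kernel `x ↦ k(|x|)` on `ℝⁿ` has integral `1`. -/
structure IsKernelProfile (n : ℕ) (k : ℝ → ℝ) : Prop where
  even : ∀ t, k (-t) = k t
  nonneg : ∀ t, 0 ≤ k t
  tsupport_subset : tsupport k ⊆ Icc (-1) 1
  integral_eq_one : ∫ x : Euc n, k ‖x‖ = 1

/-- The rescaled kernel `k_ε(x) = ε⁻ⁿ k(|x / ε|)` on `ℝⁿ`. -/
noncomputable def scaledKernel {n : ℕ} (k : ℝ → ℝ) (ε : ℝ) (x : Euc n) : ℝ :=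
  (ε ^ n)⁻¹ * k ‖ε⁻¹ • x‖

/-- `(δV ∗ ρ_ε)(x)`: the distribution `δV` applied to the scalar function `y ↦ ρ_ε(x - y)`, as the
vector with coordinates `δV(ρ_ε(x - ·) eᵢ)`. -/
noncomputable def regularizedFirstVariation {d n : ℕ} (V : Measure (Euc n × Grass d n))
    (ρ : ℝ → ℝ) (ε : ℝ) (x : Euc n) : Euc n :=
  WithLp.toLp 2 fun i => firstVariation V fun y =>
    scaledKernel ρ ε (x - y) • EuclideanSpace.single i (1 : ℝ)

/-- `(‖V‖ ∗ ξ_ε)(x)`. -/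
noncomputable def regularizedMass {d n : ℕ} (V : Measure (Euc n × Grass d n))
    (ξ : ℝ → ℝ) (ε : ℝ) (x : Euc n) : ℝ :=
  ∫ y, scaledKernel ξ ε (x - y) ∂(varifoldMass V)

/-- `C_k = d ω_d ∫₀¹ k(r) r^{d-1} dr`, with `ω_d` the volume of the unit ball of `ℝᵈ`. -/
noncomputable def kernelConst (d : ℕ) (k : ℝ → ℝ) : ℝ :=
  d * (volume (Metric.ball (0 : Euc d) 1)).toReal * ∫ r in (0 : ℝ)..1, k r * r ^ (d - 1)

/-- The approximate mean curvature
`H^V_{ρ,ξ,ε}(x) = -(C_ξ / C_ρ) (δV ∗ ρ_ε)(x) / (‖V‖ ∗ ξ_ε)(x)`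
(meaningful when `(‖V‖ ∗ ξ_ε)(x) > 0`). -/
noncomputable def approxMeanCurvature {d n : ℕ} (V : Measure (Euc n × Grass d n))
    (ρ ξ : ℝ → ℝ) (ε : ℝ) (x : Euc n) : Euc n :=
  -((kernelConst d ξ / kernelConst d ρ) •
    ((regularizedMass V ξ ε x)⁻¹ • regularizedFirstVariation V ρ ε x))

/-! Write `δV = -H‖V‖ + σν` with `ν` singular to `‖V‖`. At `‖V‖`-almost every `x`, `x` is a Lebesgue
point of `H` and `|σ|ν` has zero density relative to `‖V‖`. At such a point everything rests on the
existence and positivity of the `d`-density `Θ = lim r⁻ᵈ‖V‖(B(x,r))`.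

Existence of `Θ`: the two conditions at `x` give `|H|‖V‖(B) + |σ|ν(B) ≤ C‖V‖(B)` on all small balls
`B` about `x`. Testing `δV` with radial fields then yields the monotonicity formula: `exp(Cr) r⁻ᵈ
‖V‖(B(x,r))` is nondecreasing (`IsFirstVariationControlledAt.exists_tendsto_density`). Positivity:
`‖V‖` is `θ ℋᵈ` on `M`, hence carried by countably many sets of finite `ℋᵈ`-measure, and such sets
do not charge points of density zero (`measure_inter_zeroDensitySet`).

The kernels are radial, so the density alone determines their asymptotics: `ε⁻ᵈ ∫ k(|y-x|/ε) d‖V‖`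
tends to `(Θ/ω_d) C_k` (`tendsto_integral_radial`). Replacing `H` by `H(x)` and dropping `σν` costs
`o(1)` at this scale. After the common power of `ε` cancels, the quotient of the limits is
`-(C_ξ/C_ρ) · (-C_ρ H(x)) / C_ξ = H(x)`.

Existence of `H` is the Riesz representation of each coordinate of `δV`, extended from `C¹_c` to
`C_c` by mollification, followed by Lebesgue decomposition with respect to `‖V‖`
(`exists_isGeneralizedMeanCurvature`). -/

/-! ### The Grassmannian: traces and compactness. -/

namespace Grass

variable {d n : ℕ}

theorem trace_eq (P : Grass d n) :
    LinearMap.trace ℝ (Euc n) (P : Euc n →L[ℝ] Euc n).toLinearMap = d := by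
  have h : IsIdempotentElem (P : Euc n →L[ℝ] Euc n).toLinearMap := by
    have := P.2.1.isIdempotentElem
    ext1 x
    exact congrArg (fun f : Euc n →L[ℝ] Euc n => f x) this
  rw [(LinearMap.IsIdempotentElem.isProj_range _ h).trace, P.2.2]

theorem inner_apply_self_le (P : Grass d n) (z : Euc n) :
    ⟪(P : Euc n →L[ℝ] Euc n) z, z⟫ ≤ ‖z‖ ^ 2 := by
  have h1 : ‖(P : Euc n →L[ℝ] Euc n)‖ ≤ 1 := P.2.1.norm_le
  calc ⟪(P : Euc n →L[ℝ] Euc n) z, z⟫ ≤ ‖(P : Euc n →L[ℝ] Euc n) z‖ * ‖z‖ := real_inner_le_norm _ _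
    _ ≤ (1 * ‖z‖) * ‖z‖ := by
      gcongr
      exact (P : Euc n →L[ℝ] Euc n).le_of_opNorm_le h1 z
    _ = ‖z‖ ^ 2 := by ring

theorem sum_inner_single (P : Grass d n) :
    ∑ j : Fin n, ⟪(P : Euc n →L[ℝ] Euc n) (EuclideanSpace.single j 1),
      EuclideanSpace.single j (1 : ℝ)⟫ = d := by
  rw [← trace_eq P, LinearMap.trace_eq_sum_inner _ (EuclideanSpace.basisFun (Fin n) ℝ)]
  simp [real_inner_comm]

/-- For an idempotent the rank equals the trace, so the rank condition becomes a closed one; star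
projections have norm at most one. Compactness makes `K × G` compact, so that continuous integrands
vanishing off `K × G` are integrable. -/
instance : CompactSpace (Grass d n) := by
  have h : {P : Euc n →L[ℝ] Euc n | IsStarProjection P ∧
      Module.finrank ℝ (LinearMap.range P.toLinearMap) = d} =
      {P | P * P = P} ∩ {P | star P = P} ∩
        {P | LinearMap.trace ℝ (Euc n) P.toLinearMap = d} := by
    ext P
    constructor
    · intro hP
      exact ⟨⟨hP.1.isIdempotentElem, hP.1.isSelfAdjoint⟩, trace_eq ⟨P, hP⟩⟩
    · rintro ⟨⟨h1, h2⟩, h3⟩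
      have h : IsIdempotentElem P.toLinearMap := by
        ext1 x
        exact congrArg (fun f : Euc n →L[ℝ] Euc n => f x) h1
      have h4 : LinearMap.trace ℝ (Euc n) P.toLinearMap = d := h3
      rw [(LinearMap.IsIdempotentElem.isProj_range _ h).trace] at h4
      exact ⟨⟨h1, h2⟩, by exact_mod_cast h4⟩
  apply isCompact_iff_compactSpace.mp
  change IsCompact {P : Euc n →L[ℝ] Euc n | IsStarProjection P ∧
      Module.finrank ℝ (LinearMap.range P.toLinearMap) = d}
  have : ProperSpace (Euc n →L[ℝ] Euc n) := FiniteDimensional.proper ℝ _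
  refine Metric.isCompact_of_isClosed_isBounded ?_ ?_
  · rw [h]
    refine ((isClosed_eq (by fun_prop) (by fun_prop)).inter
      (isClosed_eq (ContinuousLinearMap.adjoint (𝕜 := ℝ) (E := Euc n) (F := Euc n)).continuous
        continuous_id)).inter (isClosed_eq ?_ continuous_const)
    exact LinearMap.continuous_of_finiteDimensional
      ((LinearMap.trace ℝ (Euc n)).comp (ContinuousLinearMap.coeLM ℝ))
  · refine (Metric.isBounded_closedBall (x := (0 : Euc n →L[ℝ] Euc n)) (r := 1)).subset ?_
    intro P hP
    simpa using hP.1.norm_le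

end Grass

/-! ### Tangential divergence and linearity of the first variation. -/

section FirstVariation

variable {d n : ℕ} {Ω : Set (Euc n)} {V : Measure (Euc n × Grass d n)}

/-- Symmetry of `P` moves it from the gradient to the basis vector. The resulting expression is
visibly linear in `X` and jointly continuous in `P` and `x`. -/
theorem tangentialDiv_eq_sum_fderiv (P : Grass d n) {X : Euc n → Euc n} {x : Euc n}
    (hX : DifferentiableAt ℝ X x) :
    tangentialDiv P X x =
      ∑ j : Fin n, fderiv ℝ X x ((P : Euc n →L[ℝ] Euc n) (EuclideanSpace.single j 1)) j := by
  unfold tangentialDiv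
  refine Finset.sum_congr rfl fun j _ => ?_
  have hP : ∀ u v : Euc n, ⟪(P : Euc n →L[ℝ] Euc n) u, v⟫ = ⟪u, (P : Euc n →L[ℝ] Euc n) v⟫ := by
    intro u v
    have h := P.2.1.isSelfAdjoint.isSymmetric u v
    exact h
  rw [hP, gradient, InnerProductSpace.toDual_symm_apply]
  have h : HasFDerivAt (fun y => X y j) ((EuclideanSpace.proj j : Euc n →L[ℝ] ℝ).comp
      (fderiv ℝ X x)) x :=
    (EuclideanSpace.proj j : Euc n →L[ℝ] ℝ).hasFDerivAt.comp x hX.hasFDerivAt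
  rw [h.fderiv]
  simp

theorem tangentialDiv_eq_zero (P : Grass d n) {X : Euc n → Euc n} {x : Euc n}
    (hX : x ∉ tsupport X) : tangentialDiv P X x = 0 := by
  have h : X =ᶠ[𝓝 x] fun _ => 0 := notMem_tsupport_iff_eventuallyEq.mp hX
  have h1 : DifferentiableAt ℝ X x := h.differentiableAt_iff.mpr (differentiableAt_const _)
  rw [tangentialDiv_eq_sum_fderiv P h1, h.fderiv_eq]
  simp

theorem continuous_tangentialDiv {X : Euc n → Euc n} (hX : ContDiff ℝ 1 X) :
    Continuous fun p : Euc n × Grass d n => tangentialDiv p.2 X p.1 := by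
  have h (p : Euc n × Grass d n) := tangentialDiv_eq_sum_fderiv p.2
    (hX.differentiable (by simp) p.1)
  simp_rw [h]
  have h2 : Continuous (fderiv ℝ X) := hX.continuous_fderiv (by simp)
  fun_prop

theorem IsVarifold.integrable_of_continuous (hV : IsVarifold Ω V) {K : Set (Euc n)}
    (hK : IsCompact K) (hKΩ : K ⊆ Ω) {g : Euc n × Grass d n → ℝ} (hg : Continuous g)
    (h0 : ∀ p, p.1 ∉ K → g p = 0) : Integrable g V := by
  have h1 : IntegrableOn g (K ×ˢ univ) V :=
    hg.continuousOn.integrableOn_of_subset_isCompact (hK.prod isCompact_univ)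
      (hK.measurableSet.prod MeasurableSet.univ) subset_rfl (hV.finite_on_compacts K hK hKΩ).ne
  refine (integrableOn_iff_integrable_of_support_subset ?_).mp h1
  intro p hp
  by_contra hn
  exact hp (h0 p fun h => hn ⟨h, mem_univ _⟩)

theorem IsVarifold.integrable_tangentialDiv (hV : IsVarifold Ω V) {X : Euc n → Euc n}
    (hX : IsTestField Ω X) :
    Integrable (fun p : Euc n × Grass d n => tangentialDiv p.2 X p.1) V :=
  hV.integrable_of_continuous hX.hasCompactSupport hX.tsupport_subset
    (continuous_tangentialDiv hX.contDiff) fun _ hp => tangentialDiv_eq_zero _ hp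

theorem IsTestField.add {X Y : Euc n → Euc n} (hX : IsTestField Ω X) (hY : IsTestField Ω Y) :
    IsTestField Ω (X + Y) :=
  ⟨hX.1.add hY.1, hX.2.add hY.2, (tsupport_add _ _).trans (union_subset hX.3 hY.3)⟩

theorem firstVariation_add (hV : IsVarifold Ω V) {X Y : Euc n → Euc n}
    (hX : IsTestField Ω X) (hY : IsTestField Ω Y) :
    firstVariation V (X + Y) = firstVariation V X + firstVariation V Y := by
  unfold firstVariation
  rw [← integral_add (hV.integrable_tangentialDiv hX) (hV.integrable_tangentialDiv hY)]
  congr with p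
  have h1 := hX.contDiff.differentiable (by simp) p.1
  have h2 := hY.contDiff.differentiable (by simp) p.1
  rw [tangentialDiv_eq_sum_fderiv _ h1, tangentialDiv_eq_sum_fderiv _ h2,
    tangentialDiv_eq_sum_fderiv _ (h1.add h2), fderiv_add h1 h2, ← Finset.sum_add_distrib]
  simp

theorem firstVariation_const_smul (c : ℝ) {X : Euc n → Euc n} (hX : IsTestField Ω X) :
    firstVariation V (c • X) = c * firstVariation V X := by
  unfold firstVariation
  rw [← integral_const_mul]
  congr with p
  have h1 := hX.contDiff.differentiable (by simp) p.1
  rw [tangentialDiv_eq_sum_fderiv _ h1, tangentialDiv_eq_sum_fderiv _ (h1.const_smul c),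
    fderiv_const_smul h1, Finset.mul_sum]
  simp

/-- The tangential divergence of a radial vector field `g(|y - x|²) (y - x)`. -/
theorem tangentialDiv_radial (P : Grass d n) {g : ℝ → ℝ} (x y : Euc n)
    (hg : DifferentiableAt ℝ g (‖y - x‖ ^ 2)) :
    tangentialDiv P (fun z => g (‖z - x‖ ^ 2) • (z - x)) y =
      d * g (‖y - x‖ ^ 2) + 2 * deriv g (‖y - x‖ ^ 2) *
        ⟪(P : Euc n →L[ℝ] Euc n) (y - x), y - x⟫ := by
  have h1 : HasFDerivAt (fun z : Euc n => z - x) (ContinuousLinearMap.id ℝ (Euc n)) y :=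
    (hasFDerivAt_id y).sub_const x
  have h2 : HasFDerivAt (fun z : Euc n => ‖z - x‖ ^ 2)
      (2 • (innerSL ℝ (y - x))) y := by
    simpa using h1.norm_sq
  have h3 := hg.hasDerivAt.comp_hasFDerivAt y h2
  have h4 : HasFDerivAt (fun z => g (‖z - x‖ ^ 2) • (z - x)) _ y := h3.smul h1
  have hP : ∀ u v : Euc n, ⟪(P : Euc n →L[ℝ] Euc n) u, v⟫ = ⟪u, (P : Euc n →L[ℝ] Euc n) v⟫ :=
    fun u v => P.2.1.isSelfAdjoint.isSymmetric u v
  -- The constant `d` is written as the trace of `P`, so that both sides can be compared term by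
  -- term.
  rw [tangentialDiv_eq_sum_fderiv P h4.differentiableAt, h4.fderiv, ← P.sum_inner_single,
    Finset.sum_mul]
  have h5 : ⟪(P : Euc n →L[ℝ] Euc n) (y - x), y - x⟫ =
      ∑ j, ⟪y - x, (P : Euc n →L[ℝ] Euc n) (EuclideanSpace.single j 1)⟫ * (y - x) j := by
    conv_lhs => rw [hP, real_inner_comm, hP, PiLp.inner_apply]
    refine Finset.sum_congr rfl fun j _ => ?_
    rw [← hP]
    simp [EuclideanSpace.inner_single_right, mul_comm]
  rw [h5, Finset.mul_sum, ← Finset.sum_add_distrib]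
  refine Finset.sum_congr rfl fun j _ => ?_
  simp [EuclideanSpace.inner_single_right, inner_sub_left]
  ring

end FirstVariation

/-! ### Riesz representation of signed, locally bounded functionals. -/

section SignedRiesz

open CompactlySupportedContinuousMap CompactlySupported
open scoped NNReal

variable {X : Type*} [TopologicalSpace X]

/-- A linear functional on `C_c(X, ℝ)` is locally bounded if it is bounded in the uniform norm on
the functions supported in any given compact set. -/
def IsLocallyBoundedFunctional (L : C_c(X, ℝ) →ₗ[ℝ] ℝ) : Prop :=
  ∀ K : Set X, IsCompact K → ∃ c : ℝ, ∀ f : C_c(X, ℝ), tsupport f ⊆ K →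
    ∀ B : ℝ, 0 ≤ B → (∀ x, |f x| ≤ B) → |L f| ≤ c * B

namespace IsLocallyBoundedFunctional

variable {L : C_c(X, ℝ) →ₗ[ℝ] ℝ}

/-- Every `g` with `0 ≤ g ≤ f` is supported in the support of `f` and bounded by the same constant,
so one local bound serves for all of them. -/
theorem bddAbove (hL : IsLocallyBoundedFunctional L) (f : C_c(X, ℝ≥0)) :
    BddAbove {a | ∃ g : C_c(X, ℝ≥0), g ≤ f ∧ L g.toReal = a} := by
  obtain ⟨c, hc⟩ := hL (tsupport f.toReal) f.toReal.hasCompactSupport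
  obtain ⟨B, hB⟩ : ∃ B : ℝ, ∀ x, ‖f.toReal x‖ ≤ B :=
    HasCompactSupport.exists_bound_of_continuous f.toReal.hasCompactSupport f.toReal.continuous
  refine ⟨c * |B|, ?_⟩
  rintro _ ⟨g, hg, rfl⟩
  have hg' (x : X) : (g x : ℝ) ≤ f x := NNReal.coe_le_coe.mpr (hg x)
  have hsupp : tsupport g.toReal ⊆ tsupport f.toReal := by
    refine closure_mono fun x hx hx0 => hx ?_
    have h := hg' x
    rw [← toReal_apply f, hx0] at h
    rw [toReal_apply]
    exact le_antisymm h (NNReal.coe_nonneg _)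
  refine (le_abs_self _).trans (hc _ hsupp _ (abs_nonneg B) fun x => ?_)
  have h := hB x
  rw [toReal_apply, Real.norm_of_nonneg (NNReal.coe_nonneg _)] at h
  rw [toReal_apply, abs_of_nonneg (NNReal.coe_nonneg _)]
  exact (hg' x).trans (h.trans (le_abs_self B))

/-- The supremum defining the positive part of a locally bounded functional. -/
noncomputable def posPartAux (L : C_c(X, ℝ) →ₗ[ℝ] ℝ) (f : C_c(X, ℝ≥0)) : ℝ :=
  sSup {a | ∃ g : C_c(X, ℝ≥0), g ≤ f ∧ L g.toReal = a}

theorem le_posPartAux (hL : IsLocallyBoundedFunctional L) {f g : C_c(X, ℝ≥0)} (h : g ≤ f) :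
    L g.toReal ≤ posPartAux L f :=
  le_csSup (hL.bddAbove f) ⟨g, h, rfl⟩

theorem posPartAux_le {f : C_c(X, ℝ≥0)} {b : ℝ} (h : ∀ g ≤ f, L g.toReal ≤ b) :
    posPartAux L f ≤ b := by
  refine csSup_le ⟨_, f, le_rfl, rfl⟩ ?_
  rintro _ ⟨g, hg, rfl⟩
  exact h g hg

theorem posPartAux_nonneg (hL : IsLocallyBoundedFunctional L) (f : C_c(X, ℝ≥0)) :
    0 ≤ posPartAux L f := by
  have h0 : (0 : C_c(X, ℝ≥0)).toReal = 0 := by ext; simp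
  have h := hL.le_posPartAux (f := f) (g := 0) (fun x => by simp)
  rwa [h0, map_zero] at h

/-- The nontrivial inequality is the Riesz decomposition property: `g ≤ f₁ + f₂` splits as `g ⊓ f₁`
plus a remainder, and the remainder is at most `f₂`. -/
theorem posPartAux_add (hL : IsLocallyBoundedFunctional L) (f₁ f₂ : C_c(X, ℝ≥0)) :
    posPartAux L (f₁ + f₂) = posPartAux L f₁ + posPartAux L f₂ := by
  apply le_antisymm
  · refine posPartAux_le fun g hg => ?_
    have hg' : ∀ x, g x ≤ f₁ x + f₂ x := hg
    obtain ⟨g₂, hg₂⟩ := CompactlySupportedContinuousMap.exists_add_of_le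
      (f₁ := g ⊓ f₁) (f₂ := g) inf_le_left
    rw [← hg₂, toReal_add, map_add]
    refine add_le_add (hL.le_posPartAux inf_le_right) (hL.le_posPartAux fun x => ?_)
    have h : min (g x) (f₁ x) + g₂ x = g x := congrArg (fun f : C_c(X, ℝ≥0) => f x) hg₂
    have h' := hg' x
    rcases min_cases (g x) (f₁ x) with ⟨h1, h2⟩ | ⟨h1, h2⟩
    · rw [h1] at h
      have : g₂ x = 0 := by simpa using h
      change g₂ x ≤ f₂ x
      simp [this]
    · rw [h1] at h
      rw [← h] at h'
      exact le_of_add_le_add_left h'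
  · rw [← le_sub_iff_add_le]
    refine posPartAux_le fun g₁ h₁ => ?_
    rw [le_sub_comm]
    refine posPartAux_le fun g₂ h₂ => ?_
    rw [le_sub_iff_add_le', ← map_add, ← toReal_add]
    exact hL.le_posPartAux (add_le_add h₁ h₂)

theorem le_posPartAux_smul (hL : IsLocallyBoundedFunctional L) (r : ℝ≥0) (f : C_c(X, ℝ≥0)) :
    posPartAux L f * r ≤ posPartAux L (r • f) := by
  rcases eq_or_ne r 0 with rfl | hr
  · simpa using hL.posPartAux_nonneg _
  have hr' : (0 : ℝ) < r := by positivity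
  rw [← le_div_iff₀ hr']
  refine posPartAux_le fun g hg => ?_
  rw [le_div_iff₀ hr', mul_comm]
  have h : L (r • g).toReal = r * L g.toReal := by
    rw [toReal_smul]
    exact map_smul L (r : ℝ) g.toReal
  rw [← h]
  refine hL.le_posPartAux fun x => ?_
  exact mul_le_mul_right (show g x ≤ f x from hg x) r

theorem posPartAux_smul (hL : IsLocallyBoundedFunctional L) (r : ℝ≥0) (f : C_c(X, ℝ≥0)) :
    posPartAux L (r • f) = r * posPartAux L f := by
  rw [mul_comm]
  refine le_antisymm ?_ (hL.le_posPartAux_smul r f)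
  rcases eq_or_ne r 0 with rfl | hr
  · rw [zero_smul]
    refine posPartAux_le fun g hg => ?_
    have h0 : g.toReal = 0 := by
      ext x
      have : g x ≤ 0 := hg x
      simpa using this
    simp [h0]
  -- The reverse inequality is the one already proved, applied to `r⁻¹` and `r • f`.
  · have h := hL.le_posPartAux_smul r⁻¹ (r • f)
    rw [smul_smul, inv_mul_cancel₀ hr, one_smul] at h
    have hr' : (0 : ℝ) < r := by positivity
    rw [NNReal.coe_inv] at h
    exact (mul_inv_le_iff₀ hr').mp h

/-- The positive part of a locally bounded functional. -/
noncomputable def posPart (hL : IsLocallyBoundedFunctional L) : C_c(X, ℝ≥0) →ₗ[ℝ≥0] ℝ≥0 where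
  toFun f := ⟨posPartAux L f, hL.posPartAux_nonneg f⟩
  map_add' f g := NNReal.eq (hL.posPartAux_add f g)
  map_smul' r f := NNReal.eq (hL.posPartAux_smul r f)

/-- The negative part of a locally bounded functional. -/
noncomputable def negPart (hL : IsLocallyBoundedFunctional L) : C_c(X, ℝ≥0) →ₗ[ℝ≥0] ℝ≥0 where
  toFun f := ⟨posPartAux L f - L f.toReal, sub_nonneg.mpr (hL.le_posPartAux le_rfl)⟩
  map_add' f g := NNReal.eq <| by
    change posPartAux L (f + g) - L (f + g).toReal =
      (posPartAux L f - L f.toReal) + (posPartAux L g - L g.toReal)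
    rw [hL.posPartAux_add, toReal_add, map_add]
    ring
  map_smul' r f := NNReal.eq <| by
    change posPartAux L (r • f) - L (r • f).toReal = r * (posPartAux L f - L f.toReal)
    have h : L (r • f).toReal = r * L f.toReal := by
      rw [toReal_smul]
      exact map_smul L (r : ℝ) f.toReal
    rw [hL.posPartAux_smul, h]
    ring

/-- A locally bounded functional on `C_c(X, ℝ)` is the difference of two Radon measures. -/
theorem exists_measures [T2Space X] [LocallyCompactSpace X] [MeasurableSpace X] [BorelSpace X]
    (hL : IsLocallyBoundedFunctional L) :
    ∃ μ ν : Measure X, IsFiniteMeasureOnCompacts μ ∧ IsFiniteMeasureOnCompacts ν ∧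
      ∀ f : C_c(X, ℝ), L f = ∫ x, f x ∂μ - ∫ x, f x ∂ν := by
  have key (f : C_c(X, ℝ≥0)) : L f.toReal = ∫ x, (f x : ℝ) ∂(NNRealRMK.rieszMeasure hL.posPart) -
      ∫ x, (f x : ℝ) ∂(NNRealRMK.rieszMeasure hL.negPart) := by
    rw [NNRealRMK.integral_rieszMeasure, NNRealRMK.integral_rieszMeasure]
    change L f.toReal = posPartAux L f - (posPartAux L f - L f.toReal)
    ring
  refine ⟨NNRealRMK.rieszMeasure hL.posPart, NNRealRMK.rieszMeasure hL.negPart, inferInstance,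
    inferInstance, fun f => ?_⟩
  have hint (μ : Measure X) [IsFiniteMeasureOnCompacts μ] (g : C_c(X, ℝ≥0)) :
      Integrable (fun x => (g x : ℝ)) μ := by
    have h : Integrable (fun x => g.toReal x) μ :=
      Continuous.integrable_of_hasCompactSupport g.toReal.continuous g.toReal.hasCompactSupport
    simpa only [toReal_apply] using h
  have hf (x : X) : f x = (f.nnrealPart x : ℝ) - ((-f).nnrealPart x : ℝ) := by
    conv_lhs => rw [← nnrealPart_sub_nnrealPart_neg f]
    simp
  conv_lhs => rw [← nnrealPart_sub_nnrealPart_neg f]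
  rw [map_sub, key, key]
  simp_rw [hf]
  rw [integral_sub (hint _ _) (hint _ _), integral_sub (hint _ _) (hint _ _)]
  ring

end IsLocallyBoundedFunctional

end SignedRiesz

/-! ### Mollification of continuous functions. -/

section Mollify

open scoped Convolution

variable {n : ℕ}

/-- Mollification at scale `1 / (k + 1)`. -/
noncomputable def mollify (k : ℕ) (f : Euc n → ℝ) : Euc n → ℝ :=
  let φ : ContDiffBump (0 : Euc n) :=
    ⟨1 / (2 * (k + 1)), 1 / (k + 1), by positivity, by
      rw [div_lt_div_iff_of_pos_left one_pos (by positivity) (by positivity)]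
      have : (0 : ℝ) ≤ k := by positivity
      linarith⟩
  φ.normed volume ⋆[ContinuousLinearMap.lsmul ℝ ℝ, volume] f

theorem mollify_add (k : ℕ) {f g : Euc n → ℝ} (hf : Continuous f) (hg : Continuous g) :
    mollify k (f + g) = mollify k f + mollify k g := by
  refine ConvolutionExists.distrib_add ?_ ?_
  · exact (ContDiffBump.hasCompactSupport_normed _).convolutionExists_left _
      (ContDiffBump.continuous_normed _) hf.locallyIntegrable
  · exact (ContDiffBump.hasCompactSupport_normed _).convolutionExists_left _
      (ContDiffBump.continuous_normed _) hg.locallyIntegrable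

theorem mollify_smul (k : ℕ) (c : ℝ) (f : Euc n → ℝ) :
    mollify k (c • f) = c • mollify k f :=
  convolution_smul

theorem contDiff_mollify (k : ℕ) {f : Euc n → ℝ} (hf : Continuous f) :
    ContDiff ℝ 1 (mollify k f) :=
  (ContDiffBump.hasCompactSupport_normed _).contDiff_convolution_left _
    (ContDiffBump.contDiff_normed _ (n := 1)) hf.locallyIntegrable

theorem abs_mollify_le (k : ℕ) {f : Euc n → ℝ} (hf : Continuous f) {B : ℝ}
    (hB : ∀ x, |f x| ≤ B) (x : Euc n) : |mollify k f x| ≤ B := by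
  have h0 : 0 ≤ B := (abs_nonneg _).trans (hB x)
  rw [← Real.dist_0_eq_abs]
  exact dist_convolution_le h0 (ContDiffBump.support_normed_eq _).subset
    (ContDiffBump.nonneg_normed _) (ContDiffBump.integral_normed _) hf.aestronglyMeasurable
    fun y _ => by rw [Real.dist_0_eq_abs]; exact hB y

theorem tsupport_mollify_subset {f : Euc n → ℝ} {δ : ℝ} {k : ℕ}
    (hk : 1 / ((k : ℝ) + 1) < δ) :
    tsupport (mollify k f) ⊆ Metric.cthickening δ (tsupport f) := by
  refine closure_minimal ?_ Metric.isClosed_cthickening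
  refine (support_convolution_subset _).trans ?_
  rw [ContDiffBump.support_normed_eq]
  rintro _ ⟨a, ha, b, hb, rfl⟩
  refine Metric.mem_cthickening_of_dist_le _ b _ _ (subset_tsupport f hb) ?_
  rw [Metric.mem_ball, dist_zero_right] at ha
  simpa [dist_eq_norm] using ha.le.trans hk.le

theorem eventually_one_div_lt {δ : ℝ} (hδ : 0 < δ) :
    ∀ᶠ k : ℕ in atTop, 1 / ((k : ℝ) + 1) < δ :=
  tendsto_one_div_add_atTop_nhds_zero_nat.eventually (gt_mem_nhds hδ)

theorem eventually_abs_mollify_sub_le {f : Euc n → ℝ} (hf : Continuous f)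
    (hfc : HasCompactSupport f) {ε : ℝ} (hε : 0 < ε) :
    ∀ᶠ k in atTop, ∀ x, |mollify k f x - f x| ≤ ε := by
  obtain ⟨δ, hδ, h⟩ := Metric.uniformContinuous_iff.mp
    (hfc.uniformContinuous_of_continuous hf) ε hε
  filter_upwards [eventually_one_div_lt hδ] with k hk x
  rw [← Real.dist_eq]
  refine ContDiffBump.dist_normed_convolution_le hf.aestronglyMeasurable fun y hy => ?_
  exact (h (lt_trans (Metric.mem_ball.mp hy) hk)).le

end Mollify

/-! ### From functionals on `C¹_c(Ω)` to Radon measures. -/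

section TestFunction

variable {n : ℕ} {Ω : Set (Euc n)}

/-- The space `C¹_c(Ω, ℝ)` of scalar test functions. -/
structure IsTestFunction (Ω : Set (Euc n)) (f : Euc n → ℝ) : Prop where
  contDiff : ContDiff ℝ 1 f
  hasCompactSupport : HasCompactSupport f
  tsupport_subset : tsupport f ⊆ Ω

/-- A functional on `C¹_c(Ω, ℝ)` that is linear and locally bounded in the uniform norm. -/
structure IsLocallyBoundedOnTest (Ω : Set (Euc n)) (L : (Euc n → ℝ) → ℝ) : Prop where
  add : ∀ f g, IsTestFunction Ω f → IsTestFunction Ω g → L (f + g) = L f + L g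
  smul : ∀ (c : ℝ) f, IsTestFunction Ω f → L (c • f) = c * L f
  bound : ∀ K : Set (Euc n), IsCompact K → K ⊆ Ω → ∃ c : ℝ, ∀ f, IsTestFunction Ω f →
    tsupport f ⊆ K → ∀ B : ℝ, (∀ x, |f x| ≤ B) → |L f| ≤ c * B

/-- The compactly supported continuous functions on `Ω`. -/
structure IsCcOn (Ω : Set (Euc n)) (f : Euc n → ℝ) : Prop where
  continuous : Continuous f
  hasCompactSupport : HasCompactSupport f
  tsupport_subset : tsupport f ⊆ Ω

theorem IsTestFunction.isCcOn {f : Euc n → ℝ} (hf : IsTestFunction Ω f) : IsCcOn Ω f :=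
  ⟨hf.1.continuous, hf.2, hf.3⟩

theorem IsTestFunction.sub {f g : Euc n → ℝ} (hf : IsTestFunction Ω f)
    (hg : IsTestFunction Ω g) : IsTestFunction Ω (f - g) :=
  ⟨hf.1.sub hg.1, hf.2.sub hg.2, (tsupport_sub _ _).trans (union_subset hf.3 hg.3)⟩

/-- The constant in a local bound depends on the compact set, so the late mollifications must all
live in one compact subset of `Ω`; a closed thickening of `K` serves, and it depends on `K` only,
not on `f`. -/
theorem exists_compact_tsupport_mollify (hΩ : IsOpen Ω) {K : Set (Euc n)} (hK : IsCompact K)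
    (hKΩ : K ⊆ Ω) : ∃ K', IsCompact K' ∧ K' ⊆ Ω ∧ K ⊆ K' ∧
      ∀ f : Euc n → ℝ, tsupport f ⊆ K → Continuous f → HasCompactSupport f →
        ∀ᶠ k in atTop, IsTestFunction Ω (mollify k f) ∧ tsupport (mollify k f) ⊆ K' := by
  obtain ⟨δ, hδ, hsub⟩ := hK.exists_cthickening_subset_open hΩ hKΩ
  refine ⟨Metric.cthickening δ K, hK.cthickening, hsub, Metric.self_subset_cthickening _,
    fun f hfK hf hfc => ?_⟩
  filter_upwards [eventually_one_div_lt hδ] with k hk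
  have h : tsupport (mollify k f) ⊆ Metric.cthickening δ K :=
    (tsupport_mollify_subset hk).trans (Metric.cthickening_subset_of_subset _ hfK)
  exact ⟨⟨contDiff_mollify k hf, hK.cthickening.of_isClosed_subset (isClosed_tsupport _) h,
    h.trans hsub⟩, h⟩

namespace IsLocallyBoundedOnTest

variable {L : (Euc n → ℝ) → ℝ}

theorem sub (hL : IsLocallyBoundedOnTest Ω L) {f g : Euc n → ℝ} (hf : IsTestFunction Ω f)
    (hg : IsTestFunction Ω g) : L (f - g) = L f - L g := by
  have h := hL.add (f - g) g (hf.sub hg) hg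
  rw [sub_add_cancel] at h
  linarith

/-- The extension of a functional from `C¹_c(Ω)` to `C_c(Ω)` by mollification. -/
noncomputable def extension (L : (Euc n → ℝ) → ℝ) (f : Euc n → ℝ) : ℝ :=
  limUnder atTop fun k => L (mollify k f)

/-- A strictly positive constant allows the error tolerances below to be divided by it. -/
theorem exists_bound_nonneg (hL : IsLocallyBoundedOnTest Ω L) {K : Set (Euc n)}
    (hK : IsCompact K) (hKΩ : K ⊆ Ω) : ∃ c : ℝ, 0 < c ∧ ∀ f, IsTestFunction Ω f →
      tsupport f ⊆ K → ∀ B : ℝ, (∀ x, |f x| ≤ B) → |L f| ≤ c * B := by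
  obtain ⟨c, hc⟩ := hL.bound K hK hKΩ
  refine ⟨max c 1, by positivity, fun f hf hfK B hB => (hc f hf hfK B hB).trans ?_⟩
  have hB0 : 0 ≤ B := (abs_nonneg _).trans (hB 0)
  gcongr
  exact le_max_left _ _

/-- The mollifications are uniformly Cauchy with supports in one compact set, so the sup-norm bound
makes their images Cauchy. No control of derivatives is needed. -/
theorem tendsto_extension (hΩ : IsOpen Ω) (hL : IsLocallyBoundedOnTest Ω L) {f : Euc n → ℝ}
    (hf : IsCcOn Ω f) : Tendsto (fun k => L (mollify k f)) atTop (𝓝 (extension L f)) := by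
  apply CauchySeq.tendsto_limUnder
  obtain ⟨K', hK', hK'Ω, -, hev⟩ := exists_compact_tsupport_mollify hΩ hf.2 hf.3
  obtain ⟨c, hc0, hc⟩ := hL.exists_bound_nonneg hK' hK'Ω
  rw [Metric.cauchySeq_iff]
  intro ε hε
  obtain ⟨N, hN⟩ := eventually_atTop.mp ((hev f subset_rfl hf.1 hf.2).and
    (eventually_abs_mollify_sub_le hf.1 hf.2 (ε := ε / (4 * c)) (by positivity)))
  refine ⟨N, fun k hk l hl => ?_⟩
  obtain ⟨⟨hk1, hk2⟩, hk3⟩ := hN k hk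
  obtain ⟨⟨hl1, hl2⟩, hl3⟩ := hN l hl
  rw [Real.dist_eq, ← hL.sub hk1 hl1]
  refine (hc _ (hk1.sub hl1) ((tsupport_sub _ _).trans (union_subset hk2 hl2))
    (ε / (4 * c) + ε / (4 * c)) fun x => ?_).trans_lt ?_
  · have : (mollify k f - mollify l f) x = (mollify k f x - f x) - (mollify l f x - f x) := by
      simp
    rw [this]
    exact (abs_sub _ _).trans (add_le_add (hk3 x) (hl3 x))
  · field_simp
    linarith

theorem extension_eq (hΩ : IsOpen Ω) (hL : IsLocallyBoundedOnTest Ω L) {f : Euc n → ℝ}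
    (hf : IsTestFunction Ω f) : extension L f = L f := by
  refine tendsto_nhds_unique (hL.tendsto_extension hΩ hf.isCcOn) ?_
  obtain ⟨K', hK', hK'Ω, hKK', hev⟩ := exists_compact_tsupport_mollify hΩ hf.2 hf.3
  obtain ⟨c, hc0, hc⟩ := hL.exists_bound_nonneg hK' hK'Ω
  rw [Metric.tendsto_nhds]
  intro ε hε
  filter_upwards [hev f subset_rfl hf.isCcOn.1 hf.2,
    eventually_abs_mollify_sub_le hf.isCcOn.1 hf.2 (ε := ε / (2 * c)) (by positivity)]
    with k hk1 hk2
  rw [Real.dist_eq, ← hL.sub hk1.1 hf]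
  refine (hc _ (hk1.1.sub hf) ((tsupport_sub _ _).trans (union_subset hk1.2 hKK'))
    (ε / (2 * c)) hk2).trans_lt ?_
  field_simp
  linarith

theorem extension_add (hΩ : IsOpen Ω) (hL : IsLocallyBoundedOnTest Ω L) {f g : Euc n → ℝ}
    (hf : IsCcOn Ω f) (hg : IsCcOn Ω g) (hfg : IsCcOn Ω (f + g)) :
    extension L (f + g) = extension L f + extension L g := by
  refine tendsto_nhds_unique (hL.tendsto_extension hΩ hfg) ?_
  refine ((hL.tendsto_extension hΩ hf).add (hL.tendsto_extension hΩ hg)).congr' ?_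
  obtain ⟨_, _, _, _, h1⟩ := exists_compact_tsupport_mollify hΩ hf.2 hf.3
  obtain ⟨_, _, _, _, h2⟩ := exists_compact_tsupport_mollify hΩ hg.2 hg.3
  filter_upwards [h1 f subset_rfl hf.1 hf.2, h2 g subset_rfl hg.1 hg.2] with k h3 h4
  rw [mollify_add k hf.1 hg.1, hL.add _ _ h3.1 h4.1]

theorem extension_smul (hΩ : IsOpen Ω) (hL : IsLocallyBoundedOnTest Ω L) (c : ℝ) {f : Euc n → ℝ}
    (hf : IsCcOn Ω f) (hcf : IsCcOn Ω (c • f)) :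
    extension L (c • f) = c * extension L f := by
  refine tendsto_nhds_unique (hL.tendsto_extension hΩ hcf) ?_
  refine ((hL.tendsto_extension hΩ hf).const_mul c).congr' ?_
  obtain ⟨_, _, _, _, h1⟩ := exists_compact_tsupport_mollify hΩ hf.2 hf.3
  filter_upwards [h1 f subset_rfl hf.1 hf.2] with k h3
  rw [mollify_smul, hL.smul _ _ h3.1]

theorem extension_bound (hΩ : IsOpen Ω) (hL : IsLocallyBoundedOnTest Ω L) {K : Set (Euc n)}
    (hK : IsCompact K) (hKΩ : K ⊆ Ω) : ∃ c : ℝ, ∀ f, IsCcOn Ω f →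
      tsupport f ⊆ K → ∀ B : ℝ, (∀ x, |f x| ≤ B) → |extension L f| ≤ c * B := by
  obtain ⟨K', hK', hK'Ω, -, hev⟩ := exists_compact_tsupport_mollify hΩ hK hKΩ
  obtain ⟨c, hc0, hc⟩ := hL.exists_bound_nonneg hK' hK'Ω
  refine ⟨c, fun f hf hfK B hB => ?_⟩
  refine le_of_tendsto (hL.tendsto_extension hΩ hf).abs ?_
  filter_upwards [hev f hfK hf.1 hf.2] with k hk
  exact hc _ hk.1 hk.2 B (abs_mollify_le k hf.1 hB)

open CompactlySupported

/-- Riesz representation is applied on the locally compact space `Ω`, whereas test functions live on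
`ℝⁿ`; extension by zero passes from one to the other. -/
theorem isCcOn_extend (hΩ : IsOpen Ω) (f : C_c(Ω, ℝ)) :
    IsCcOn Ω (Function.extend Subtype.val f 0) :=
  ⟨f.hasCompactSupport.continuous_extend_zero hΩ f.continuous,
    f.hasCompactSupport.extend_zero continuous_subtype_val,
    (f.hasCompactSupport.tsupport_extend_zero_subset continuous_subtype_val).trans
      (Subtype.coe_image_subset _ _)⟩

/-- The extension of a locally bounded functional on `C¹_c(Ω)` as a linear map on `C_c(Ω)`. -/
noncomputable def linearExtension (hΩ : IsOpen Ω) (hL : IsLocallyBoundedOnTest Ω L) :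
    C_c(Ω, ℝ) →ₗ[ℝ] ℝ where
  toFun f := extension L (Function.extend Subtype.val f 0)
  map_add' f g := by
    have h : Function.extend Subtype.val (f + g : C_c(Ω, ℝ)) (0 : Euc n → ℝ) =
        Function.extend Subtype.val f 0 + Function.extend Subtype.val g 0 := by
      simpa using (Function.extend_add (Subtype.val : Ω → Euc n) f g 0 0)
    have h1 := isCcOn_extend hΩ (f + g)
    rw [h] at h1 ⊢
    exact hL.extension_add hΩ (isCcOn_extend hΩ f) (isCcOn_extend hΩ g) h1
  map_smul' c f := by
    have h : Function.extend Subtype.val (c • f : C_c(Ω, ℝ)) (0 : Euc n → ℝ) =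
        c • Function.extend Subtype.val f 0 := by
      simpa using (Function.extend_smul c (Subtype.val : Ω → Euc n) f 0)
    have h1 := isCcOn_extend hΩ (c • f)
    rw [h] at h1 ⊢
    exact hL.extension_smul hΩ c (isCcOn_extend hΩ f) h1

theorem isLocallyBoundedFunctional (hΩ : IsOpen Ω) (hL : IsLocallyBoundedOnTest Ω L) :
    IsLocallyBoundedFunctional (hL.linearExtension hΩ) := by
  intro K hK
  obtain ⟨c, hc⟩ := hL.extension_bound hΩ (hK.image continuous_subtype_val)
    (Subtype.coe_image_subset _ _)
  refine ⟨c, fun f hfK B hB0 hB => hc _ (isCcOn_extend hΩ f) ?_ B fun x => ?_⟩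
  · exact (f.hasCompactSupport.tsupport_extend_zero_subset continuous_subtype_val).trans
      (image_mono hfK)
  · by_cases hx : x ∈ Ω
    · have : Function.extend Subtype.val f (0 : Euc n → ℝ) x = f ⟨x, hx⟩ :=
        Subtype.val_injective.extend_apply f 0 ⟨x, hx⟩
      rw [this]
      exact hB _
    · rw [Function.extend_apply' _ _ _ fun ⟨y, hy⟩ => hx (hy ▸ y.2)]
      simpa using hB0

/-- A linear functional on `C¹_c(Ω)` that is locally bounded in the uniform norm is the difference
of two Radon measures on `Ω`. -/
theorem exists_measures (hΩ : IsOpen Ω) (hL : IsLocallyBoundedOnTest Ω L) :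
    ∃ μ ν : Measure (Euc n), μ Ωᶜ = 0 ∧ ν Ωᶜ = 0 ∧
      (∀ K : Set (Euc n), IsCompact K → K ⊆ Ω → μ K < ⊤) ∧
      (∀ K : Set (Euc n), IsCompact K → K ⊆ Ω → ν K < ⊤) ∧
      ∀ f, IsTestFunction Ω f → L f = ∫ x, f x ∂μ - ∫ x, f x ∂ν := by
  have : LocallyCompactSpace Ω := hΩ.locallyCompactSpace
  obtain ⟨μ, ν, hμ, hν, h⟩ := (hL.isLocallyBoundedFunctional hΩ).exists_measures
  have hemb : MeasurableEmbedding (Subtype.val : Ω → Euc n) :=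
    MeasurableEmbedding.subtype_coe hΩ.measurableSet
  have hpre (K : Set (Euc n)) (hK : IsCompact K) (hKΩ : K ⊆ Ω) :
      IsCompact (Subtype.val ⁻¹' K : Set Ω) :=
    Topology.IsInducing.subtypeVal.isCompact_preimage' hK (by simpa using hKΩ)
  refine ⟨μ.map Subtype.val, ν.map Subtype.val, ?_, ?_, ?_, ?_, ?_⟩
  · rw [hemb.map_apply]; simp
  · rw [hemb.map_apply]; simp
  · intro K hK hKΩ
    rw [hemb.map_apply]
    exact (hpre K hK hKΩ).measure_lt_top
  · intro K hK hKΩ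
    rw [hemb.map_apply]
    exact (hpre K hK hKΩ).measure_lt_top
  · intro f hf
    rw [hemb.integral_map, hemb.integral_map]
    let g : C_c(Ω, ℝ) := ⟨⟨fun x => f x, hf.1.continuous.comp continuous_subtype_val⟩, by
      refine (hpre _ hf.2 hf.3).of_isClosed_subset (isClosed_tsupport _) ?_
      exact closure_minimal (fun x hx => subset_tsupport f hx)
        ((isClosed_tsupport f).preimage continuous_subtype_val)⟩
    have hg : Function.extend Subtype.val g (0 : Euc n → ℝ) = f := by
      ext x
      by_cases hx : x ∈ Ω
      · exact Subtype.val_injective.extend_apply g 0 ⟨x, hx⟩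
      · rw [Function.extend_apply' _ _ _ fun ⟨y, hy⟩ => hx (hy ▸ y.2)]
        exact (image_eq_zero_of_notMem_tsupport fun h => hx (hf.3 h)).symm
    have h1 := h g
    change extension L (Function.extend Subtype.val g (0 : Euc n → ℝ)) = _ at h1
    rw [hg, hL.extension_eq hΩ hf] at h1
    exact h1

end IsLocallyBoundedOnTest

end TestFunction

/-! ### Existence of a generalized mean curvature vector. -/

section Existence

variable {d n : ℕ} {Ω : Set (Euc n)}

/-- The interiors cover `Ω`, so a small ball about any given point lies in a single `K j`; local
almost-everywhere statements can then be proved on each `K j`. -/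
theorem exists_compact_exhaustion (hΩ : IsOpen Ω) :
    ∃ K : ℕ → Set (Euc n), (∀ j, IsCompact (K j)) ∧ (∀ j, K j ⊆ Ω) ∧ Ω ⊆ ⋃ j, interior (K j) := by
  have : LocallyCompactSpace Ω := hΩ.locallyCompactSpace
  let C : CompactExhaustion Ω := default
  refine ⟨fun j => Subtype.val '' C j, fun j => (C.isCompact j).image continuous_subtype_val,
    fun j => Subtype.coe_image_subset _ _, fun x hx => ?_⟩
  obtain ⟨j, hj⟩ := C.exists_mem ⟨x, hx⟩
  refine mem_iUnion.mpr ⟨j + 1, interior_maximal (image_mono interior_subset)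
    (hΩ.isOpenMap_subtype_val _ isOpen_interior) ⟨⟨x, hx⟩, C.subset_interior_succ j hj, rfl⟩⟩

theorem sigmaFinite_of_finite_on_compacts (hΩ : IsOpen Ω) {μ : Measure (Euc n)} (h0 : μ Ωᶜ = 0)
    (h : ∀ K : Set (Euc n), IsCompact K → K ⊆ Ω → μ K < ⊤) : SigmaFinite μ := by
  obtain ⟨K, hK, hKΩ, hcov⟩ := exists_compact_exhaustion hΩ
  refine ⟨⟨⟨fun j => K j ∪ Ωᶜ, fun _ => trivial, fun j => ?_, ?_⟩⟩⟩
  · exact (measure_union_le _ _).trans_lt (by rw [h0, add_zero]; exact h _ (hK j) (hKΩ j))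
  · refine eq_univ_of_forall fun x => mem_iUnion.mpr ?_
    by_cases hx : x ∈ Ω
    · obtain ⟨j, hj⟩ := mem_iUnion.mp (hcov hx)
      exact ⟨j, Or.inl (interior_subset hj)⟩
    · exact ⟨0, Or.inr hx⟩

theorem varifoldMass_apply {V : Measure (Euc n × Grass d n)} {s : Set (Euc n)}
    (hs : MeasurableSet s) : varifoldMass V s = V (s ×ˢ univ) := by
  rw [varifoldMass, Measure.map_apply measurable_fst hs, prod_univ]

theorem IsVarifold.mass_compl {V : Measure (Euc n × Grass d n)} (hV : IsVarifold Ω V)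
    (hΩ : IsOpen Ω) : varifoldMass V Ωᶜ = 0 := by
  rw [varifoldMass_apply hΩ.measurableSet.compl, ← hV.carried]
  congr 1
  ext p
  simp

theorem IsVarifold.mass_lt_top {V : Measure (Euc n × Grass d n)} (hV : IsVarifold Ω V)
    {K : Set (Euc n)} (hK : IsCompact K) (hKΩ : K ⊆ Ω) : varifoldMass V K < ⊤ := by
  rw [varifoldMass_apply hK.measurableSet]
  exact hV.finite_on_compacts K hK hKΩ

theorem IsCcOn.integrable_mul {μ : Measure (Euc n)} {g f : Euc n → ℝ} (hf : IsCcOn Ω f)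
    (hg : IntegrableOn g (tsupport f) μ) : Integrable (fun x => f x * g x) μ := by
  refine (integrableOn_iff_integrable_of_support_subset ?_).mp
    (hg.continuousOn_mul hf.continuous.continuousOn hf.hasCompactSupport)
  intro x hx
  refine subset_tsupport f fun h => hx ?_
  simp [h]

theorem IsCcOn.integrable {μ : Measure (Euc n)} {f : Euc n → ℝ} (hf : IsCcOn Ω f)
    (h : μ (tsupport f) < ⊤) : Integrable f μ := by
  have h1 := hf.integrable_mul (μ := μ) (g := fun _ => 1) (integrableOn_const h.ne)
  simpa using h1

/-- Lebesgue decomposition of `M` with respect to `m`, the singular part being expressed through its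
density with respect to a dominating `ν`. The freedom in `ν` lets all coordinates share the same
one. -/
theorem integral_eq_integral_rnDeriv_add {M m ν : Measure (Euc n)} [SigmaFinite M] [SigmaFinite m]
    [SigmaFinite ν] (hν : M.singularPart m ≪ ν) {f : Euc n → ℝ} (hf : IsCcOn Ω f)
    (hM : M (tsupport f) < ⊤) :
    ∫ x, f x ∂M = ∫ x, f x * (M.rnDeriv m x).toReal ∂m +
      ∫ x, f x * ((M.singularPart m).rnDeriv ν x).toReal ∂ν := by
  have h1 : Integrable f (M.singularPart m) :=
    hf.integrable ((Measure.singularPart_le M m _).trans_lt hM)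
  have h2 : Integrable f (m.withDensity (M.rnDeriv m)) :=
    hf.integrable ((Measure.withDensity_rnDeriv_le M m _).trans_lt hM)
  conv_lhs => rw [Measure.haveLebesgueDecomposition_add M m]
  rw [integral_add_measure h1 h2, add_comm]
  congr 1
  · rw [integral_withDensity_eq_integral_toReal_smul (Measure.measurable_rnDeriv M m)
      (Measure.rnDeriv_lt_top M m)]
    simp [mul_comm]
  · rw [← integral_rnDeriv_smul hν]
    simp [mul_comm]

variable {V : Measure (Euc n × Grass d n)}

theorem IsTestField.zero : IsTestField Ω (0 : Euc n → Euc n) :=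
  ⟨contDiff_const, HasCompactSupport.zero, by simp [tsupport]⟩

theorem firstVariation_zero : firstVariation V 0 = 0 := by
  have h (p : Euc n × Grass d n) : tangentialDiv p.2 (0 : Euc n → Euc n) p.1 = 0 :=
    tangentialDiv_eq_zero _ (by simp [tsupport])
  simp [firstVariation, h]

theorem firstVariation_sum (hV : IsVarifold Ω V) {ι : Type*} (s : Finset ι)
    {X : ι → Euc n → Euc n} (hX : ∀ i ∈ s, IsTestField Ω (X i)) :
    IsTestField Ω (∑ i ∈ s, X i) ∧
      firstVariation V (∑ i ∈ s, X i) = ∑ i ∈ s, firstVariation V (X i) := by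
  classical
  induction s using Finset.induction_on with
  | empty => exact ⟨IsTestField.zero, firstVariation_zero⟩
  | insert a s ha ih =>
    obtain ⟨h1, h2⟩ := ih fun i hi => hX i (Finset.mem_insert_of_mem hi)
    have h3 := hX a (Finset.mem_insert_self a s)
    rw [Finset.sum_insert ha, Finset.sum_insert ha]
    exact ⟨h3.add h1, by rw [firstVariation_add hV h3 h1, h2]⟩

theorem IsTestFunction.smul_single {f : Euc n → ℝ} (hf : IsTestFunction Ω f) (i : Fin n) :
    IsTestField Ω fun x => f x • EuclideanSpace.single i (1 : ℝ) :=
  ⟨hf.1.smul contDiff_const, hf.2.smul_right, (tsupport_smul_subset_left _ _).trans hf.3⟩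

theorem IsTestField.coord {X : Euc n → Euc n} (hX : IsTestField Ω X) (i : Fin n) :
    IsTestFunction Ω fun x => X x i := by
  have h : tsupport (fun x => X x i) ⊆ tsupport X := closure_mono fun x hx h0 => hx (by simp [h0])
  exact ⟨(EuclideanSpace.proj i : Euc n →L[ℝ] ℝ).contDiff.comp hX.1,
    hX.2.of_isClosed_subset (isClosed_tsupport _) h, h.trans hX.3⟩

theorem firstVariation_eq_sum (hV : IsVarifold Ω V) {X : Euc n → Euc n} (hX : IsTestField Ω X) :
    firstVariation V X =
      ∑ i, firstVariation V fun x => X x i • EuclideanSpace.single i (1 : ℝ) := by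
  rw [← (firstVariation_sum hV Finset.univ fun i _ => (hX.coord i).smul_single i).2]
  congr 1
  ext x j
  simp [Finset.sum_apply, Pi.single_apply]

theorem isLocallyBoundedOnTest_firstVariation (hV : IsVarifold Ω V)
    (hδV : HasLocallyBoundedFirstVariation Ω V) (i : Fin n) :
    IsLocallyBoundedOnTest Ω
      fun f => firstVariation V fun x => f x • EuclideanSpace.single i (1 : ℝ) where
  add f g hf hg := by
    rw [← firstVariation_add hV (hf.smul_single i) (hg.smul_single i)]
    congr 1
    ext1 x
    simp [add_smul]
  smul c f hf := by
    rw [← firstVariation_const_smul c (hf.smul_single i)]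
    congr 1
    ext1 x
    simp [mul_smul]
  bound K hK hKΩ := by
    obtain ⟨c, hc⟩ := hδV K hK hKΩ
    refine ⟨max c 0, fun f hf hfK B hB => ?_⟩
    have hB0 : 0 ≤ B := (abs_nonneg _).trans (hB 0)
    refine (hc _ (hf.smul_single i) ((tsupport_smul_subset_left _ _).trans hfK)).trans ?_
    have h1 : ⨆ x : K, ‖f x • (EuclideanSpace.single i (1 : ℝ) : Euc n)‖ ≤ B := by
      refine Real.iSup_le (fun x => ?_) hB0
      simpa [norm_smul] using hB x
    have h2 : 0 ≤ ⨆ x : K, ‖f x • (EuclideanSpace.single i (1 : ℝ) : Euc n)‖ :=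
      Real.iSup_nonneg fun x => norm_nonneg _
    calc _ ≤ max c 0 * ⨆ x : K, ‖f x • (EuclideanSpace.single i (1 : ℝ) : Euc n)‖ := by
          gcongr
          exact le_max_left _ _
      _ ≤ _ := by gcongr

theorem integrableOn_toLp {μ : Measure (Euc n)} {s : Set (Euc n)} {g : Fin n → Euc n → ℝ}
    (hg : ∀ i, IntegrableOn (g i) s μ) :
    IntegrableOn (fun x => (WithLp.toLp 2 fun i => g i x : Euc n)) s μ := by
  have h : Integrable (fun x i => g i x) (μ.restrict s) := Integrable.of_eval hg
  exact (PiLp.continuousLinearEquiv 2 ℝ fun _ : Fin n => ℝ).symm.toContinuousLinearMap.integrable_comp h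

/-- A varifold with locally bounded first variation has a generalized mean curvature vector. -/
theorem exists_isGeneralizedMeanCurvature (hΩ : IsOpen Ω) (hV : IsVarifold Ω V)
    (hδV : HasLocallyBoundedFirstVariation Ω V) :
    ∃ H : Euc n → Euc n, IsGeneralizedMeanCurvature Ω V H := by
  choose A B hA0 hB0 hA hB hAB using fun i =>
    (isLocallyBoundedOnTest_firstVariation hV hδV i).exists_measures hΩ
  set m := varifoldMass V with hm
  have : SigmaFinite m := sigmaFinite_of_finite_on_compacts hΩ (hV.mass_compl hΩ)
    fun K hK hKΩ => hV.mass_lt_top hK hKΩ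
  have hAσ (i) : SigmaFinite (A i) := sigmaFinite_of_finite_on_compacts hΩ (hA0 i) (hA i)
  have hBσ (i) : SigmaFinite (B i) := sigmaFinite_of_finite_on_compacts hΩ (hB0 i) (hB i)
  -- A single scalar measure has to carry the singular parts of all coordinates; their sum dominates
  -- each of them and stays singular to `m`.
  let ν : Measure (Euc n) := ∑ i, ((A i).singularPart m + (B i).singularPart m)
  have hν_apply (s : Set (Euc n)) :
      ν s = ∑ i, ((A i).singularPart m s + (B i).singularPart m s) := by
    simp [ν, Measure.finsetSum_apply]
  have hν_le (s : Set (Euc n)) : ν s ≤ ∑ i, (A i s + B i s) := by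
    rw [hν_apply]
    gcongr <;> exact Measure.singularPart_le _ _
  have hν0 : ν Ωᶜ = 0 := by
    refine le_antisymm ((hν_le _).trans ?_) zero_le
    simp [hA0, hB0]
  have hνK (K : Set (Euc n)) (hK : IsCompact K) (hKΩ : K ⊆ Ω) : ν K < ⊤ :=
    (hν_le K).trans_lt (ENNReal.sum_lt_top.mpr fun i _ =>
      ENNReal.add_lt_top.mpr ⟨hA i K hK hKΩ, hB i K hK hKΩ⟩)
  have : SigmaFinite ν := sigmaFinite_of_finite_on_compacts hΩ hν0 hνK
  have hνA (i) : (A i).singularPart m ≤ ν := by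
    refine Measure.le_iff.mpr fun s _ => ?_
    rw [hν_apply]
    exact le_self_add.trans (Finset.single_le_sum (f := fun i =>
      (A i).singularPart m s + (B i).singularPart m s) (fun _ _ => zero_le) (Finset.mem_univ i))
  have hνB (i) : (B i).singularPart m ≤ ν := by
    refine Measure.le_iff.mpr fun s _ => ?_
    rw [hν_apply]
    exact le_add_self.trans (Finset.single_le_sum (f := fun i =>
      (A i).singularPart m s + (B i).singularPart m s) (fun _ _ => zero_le) (Finset.mem_univ i))
  have hνsing : ν ⟂ₘ m := by
    have h (s : Finset (Fin n)) :
        (∑ i ∈ s, ((A i).singularPart m + (B i).singularPart m)) ⟂ₘ m := by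
      induction s using Finset.induction_on with
      | empty => simp
      | insert a s ha ih =>
        rw [Finset.sum_insert ha]
        exact ((Measure.mutuallySingular_singularPart _ _).add_left
          (Measure.mutuallySingular_singularPart _ _)).add_left ih
    exact h _
  -- The `i`-th coordinate of `δV` is `A i - B i`; the order is reversed here because `H` enters
  -- `δV` with a minus sign, and kept in `s`.
  let h (i : Fin n) (x : Euc n) : ℝ := ((B i).rnDeriv m x).toReal - ((A i).rnDeriv m x).toReal
  let s (i : Fin n) (x : Euc n) : ℝ := (((A i).singularPart m).rnDeriv ν x).toReal -
    (((B i).singularPart m).rnDeriv ν x).toReal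
  have hAm (i K) (hK : IsCompact K) (hKΩ : K ⊆ Ω) :
      IntegrableOn (fun x => ((A i).rnDeriv m x).toReal) K m :=
    Measure.integrableOn_toReal_rnDeriv (hA i K hK hKΩ).ne
  have hBm (i K) (hK : IsCompact K) (hKΩ : K ⊆ Ω) :
      IntegrableOn (fun x => ((B i).rnDeriv m x).toReal) K m :=
    Measure.integrableOn_toReal_rnDeriv (hB i K hK hKΩ).ne
  have hAν (i K) (hK : IsCompact K) (hKΩ : K ⊆ Ω) :
      IntegrableOn (fun x => (((A i).singularPart m).rnDeriv ν x).toReal) K ν :=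
    Measure.integrableOn_toReal_rnDeriv
      ((Measure.singularPart_le _ _ _).trans_lt (hA i K hK hKΩ)).ne
  have hBν (i K) (hK : IsCompact K) (hKΩ : K ⊆ Ω) :
      IntegrableOn (fun x => (((B i).singularPart m).rnDeriv ν x).toReal) K ν :=
    Measure.integrableOn_toReal_rnDeriv
      ((Measure.singularPart_le _ _ _).trans_lt (hB i K hK hKΩ)).ne
  refine ⟨fun x => WithLp.toLp 2 fun i => h i x, fun K hK hKΩ => integrableOn_toLp fun i =>
    (hBm i K hK hKΩ).sub (hAm i K hK hKΩ), ν, fun x => WithLp.toLp 2 fun i => s i x, hν0,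
    fun K hK hKΩ => ⟨hνK K hK hKΩ, integrableOn_toLp fun i =>
    (hAν i K hK hKΩ).sub (hBν i K hK hKΩ)⟩, hνsing, fun X hX => ?_⟩
  have hinner (u : Euc n) (g : Fin n → ℝ) : ⟪u, (WithLp.toLp 2 g : Euc n)⟫ = ∑ i, u i * g i := by
    simp [PiLp.inner_apply, mul_comm]
  have hc (i) := (hX.coord i).isCcOn
  have hcm (i) := (hc i).integrable_mul (μ := m) (g := h i)
    ((hBm i _ (hc i).2 (hc i).3).sub (hAm i _ (hc i).2 (hc i).3))
  have hcν (i) := (hc i).integrable_mul (μ := ν) (g := s i)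
    ((hAν i _ (hc i).2 (hc i).3).sub (hBν i _ (hc i).2 (hc i).3))
  simp_rw [hinner]
  rw [firstVariation_eq_sum hV hX, integral_finsetSum _ fun i _ => hcm i,
    integral_finsetSum _ fun i _ => hcν i, ← Finset.sum_neg_distrib, ← Finset.sum_add_distrib]
  refine Finset.sum_congr rfl fun i _ => ?_
  rw [hAB i _ (hX.coord i),
    integral_eq_integral_rnDeriv_add (hνA i).absolutelyContinuous (hc i) (hA i _ (hc i).2 (hc i).3),
    integral_eq_integral_rnDeriv_add (hνB i).absolutelyContinuous (hc i) (hB i _ (hc i).2 (hc i).3)]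
  simp only [h, s, mul_sub]
  rw [integral_sub ((hc i).integrable_mul (hBm i _ (hc i).2 (hc i).3))
      ((hc i).integrable_mul (hAm i _ (hc i).2 (hc i).3)),
    integral_sub ((hc i).integrable_mul (hAν i _ (hc i).2 (hc i).3))
      ((hc i).integrable_mul (hBν i _ (hc i).2 (hc i).3))]
  ring

end Existence

/-! ### Positive density almost everywhere. -/

section Density

open scoped ENNReal

theorem tendsto_const_mul_nhdsGT_zero {a : ℝ} (ha : 0 < a) :
    Tendsto (fun r : ℝ => a * r) (𝓝[>] 0) (𝓝[>] 0) := by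
  refine tendsto_nhdsWithin_iff.mpr ⟨?_, eventually_mem_nhdsWithin.mono fun r hr =>
    mem_Ioi.mpr (mul_pos ha hr)⟩
  have : Continuous fun r : ℝ => a * r := by fun_prop
  simpa using (this.tendsto 0).mono_left nhdsWithin_le_nhds

/-- The set of points at which the `d`-dimensional density of `μ` vanishes. -/
def zeroDensitySet {X : Type*} [PseudoMetricSpace X] [MeasurableSpace X] (d : ℕ) (μ : Measure X) :
    Set X :=
  {x | ∀ t : ℝ, 0 < t → ∀ᶠ r in 𝓝[>] (0 : ℝ), μ (Metric.closedBall x r) ≤ ENNReal.ofReal (t * r ^ d)}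

section Metric

variable {X : Type*} [MetricSpace X] [MeasurableSpace X] [BorelSpace X] {d : ℕ}

/-- The outer measure `mkMetric` is the largest one bounded by `diamᵈ` on small sets. A small set
`s` meeting `D` at `x` lies in a ball about `x` of radius just above its diameter, so `t⁻¹μ`
restricted to `D` satisfies this bound. -/
theorem measure_inter_le_mul_hausdorffMeasure (μ : Measure X) {t δ : ℝ} (ht : 0 < t)
    (hδ : 0 < δ) (E : Set X) {D : Set X}
    (hD : ∀ x ∈ D, ∀ r ∈ Ioc 0 δ, μ (Metric.closedBall x r) ≤ ENNReal.ofReal (t * r ^ d)) :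
    μ (E ∩ D) ≤ ENNReal.ofReal t * μH[d] E := by
  let c : ℝ≥0∞ := (ENNReal.ofReal t)⁻¹
  have ht0 : ENNReal.ofReal t ≠ 0 := by simpa using ht
  have key : c • OuterMeasure.restrict D μ.toOuterMeasure ≤
      OuterMeasure.mkMetric fun r => r ^ (d : ℝ) := by
    refine OuterMeasure.le_mkMetric _ _ (ENNReal.ofReal (δ / 2)) (by simpa using hδ) fun s hs => ?_
    simp only [smul_apply, OuterMeasure.restrict_apply, Measure.coe_toOuterMeasure,
      smul_eq_mul, c]
    rw [ENNReal.inv_mul_le_iff ht0 ENNReal.ofReal_ne_top]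
    rcases (s ∩ D).eq_empty_or_nonempty with h | ⟨x, hxs, hxD⟩
    · simp [h]
    have hfin : Metric.ediam s ≠ ⊤ := (hs.trans_lt ENNReal.ofReal_lt_top).ne
    set a := (Metric.ediam s).toReal with ha
    have ha0 : 0 ≤ a := ENNReal.toReal_nonneg
    have haδ : a ≤ δ / 2 := ENNReal.toReal_le_of_le_ofReal (by positivity) hs
    have hsa : Metric.ediam s = ENNReal.ofReal a := (ENNReal.ofReal_toReal hfin).symm
    -- The diameter `a` may be zero, where `hD` says nothing, so radii `r > a` are used and then `r
    -- ↓ a`. The bound `a ≤ δ / 2` leaves room for them below `δ`.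
    have h1 : ∀ᶠ r in 𝓝[>] a, μ (s ∩ D) ≤ ENNReal.ofReal (t * r ^ d) := by
      filter_upwards [Ioc_mem_nhdsGT (show a < δ by linarith)] with r hr
      refine (measure_mono fun y hy => ?_).trans (hD x hxD r ⟨ha0.trans_lt hr.1, hr.2⟩)
      rw [Metric.mem_closedBall, dist_edist]
      refine (ENNReal.toReal_mono hfin (Metric.edist_le_ediam_of_mem hy.1 hxs)).trans hr.1.le
    have h2 : Tendsto (fun r : ℝ => ENNReal.ofReal (t * r ^ d)) (𝓝[>] a)
        (𝓝 (ENNReal.ofReal (t * a ^ d))) :=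
      (ENNReal.continuous_ofReal.comp (by fun_prop)).continuousAt.mono_left nhdsWithin_le_nhds
    refine (ge_of_tendsto h2 h1).trans ?_
    rw [hsa, ENNReal.ofReal_mul ht.le, ENNReal.ofReal_pow ha0, ENNReal.rpow_natCast]
  have h := key E
  rw [← Measure.mkMetric_toOuterMeasure] at h
  simp only [smul_apply, OuterMeasure.restrict_apply, Measure.coe_toOuterMeasure,
    smul_eq_mul, c] at h
  rwa [ENNReal.inv_mul_le_iff ht0 ENNReal.ofReal_ne_top] at h

/-- A set of finite Hausdorff measure does not charge the points of density zero. -/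
theorem measure_inter_zeroDensitySet (μ : Measure X) {E : Set X}
    (hE : μH[d] E < ⊤) : μ (E ∩ zeroDensitySet d μ) = 0 := by
  have h1 (t : ℝ) (ht : 0 < t) : μ (E ∩ zeroDensitySet d μ) ≤ ENNReal.ofReal t * μH[d] E := by
    let D (j : ℕ) : Set X := {x | ∀ r ∈ Ioc (0 : ℝ) (1 / (j + 1)),
      μ (Metric.closedBall x r) ≤ ENNReal.ofReal (t * r ^ d)}
    have hmono : Monotone D := fun i j hij x hx r hr =>
      hx r ⟨hr.1, hr.2.trans (one_div_le_one_div_of_le (by positivity) (by gcongr))⟩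
    have hsub : E ∩ zeroDensitySet d μ ⊆ ⋃ j, E ∩ D j := by
      rintro x ⟨hxE, hx⟩
      obtain ⟨δ, hδ, h⟩ := mem_nhdsGT_iff_exists_Ioc_subset.mp (hx t ht)
      obtain ⟨j, hj⟩ := exists_nat_one_div_lt (show 0 < δ from hδ)
      exact mem_iUnion.mpr ⟨j, hxE, fun r hr => h ⟨hr.1, hr.2.trans hj.le⟩⟩
    refine (measure_mono hsub).trans ?_
    -- Continuity along increasing unions holds for arbitrary sets, so the measurability of `D j` is
    -- irrelevant.
    rw [Monotone.measure_iUnion fun i j hij => inter_subset_inter_right _ (hmono hij)]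
    exact iSup_le fun j => measure_inter_le_mul_hausdorffMeasure μ ht
      (show (0 : ℝ) < 1 / (j + 1) by positivity) E fun x hx r hr => hx r hr
  have h2 : Tendsto (fun t : ℝ => ENNReal.ofReal t * μH[d] E) (𝓝[>] 0) (𝓝 0) := by
    have h : Tendsto (fun t : ℝ => ENNReal.ofReal t) (𝓝[>] 0) (𝓝 0) := by
      have := (ENNReal.continuous_ofReal.tendsto 0).mono_left (nhdsWithin_le_nhds (s := Ioi 0))
      simpa using this
    simpa using ENNReal.Tendsto.mul_const h (Or.inr hE.ne)
  exact le_antisymm (ge_of_tendsto h2 (eventually_mem_nhdsWithin.mono h1)) zero_le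

end Metric

variable {d n : ℕ} {Ω M : Set (Euc n)} {θ : Euc n → ℝ} {V : Measure (Euc n × Grass d n)}

theorem IsRectifiableVarifold.integral_mass (hV : IsRectifiableVarifold Ω M θ V)
    {f : Euc n → ℝ} (hf : IsCcOn Ω f) :
    ∫ x, f x ∂(varifoldMass V) = ∫ x in M, f x * θ x ∂μHE[d] := by
  obtain ⟨T, -, hT⟩ := hV.eq_integral
  have hsub : tsupport (fun p : Euc n × Grass d n => f p.1) ⊆ tsupport f ×ˢ univ :=
    closure_minimal (fun p hp => ⟨subset_tsupport f hp, mem_univ _⟩)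
      ((isClosed_tsupport f).prod isClosed_univ)
  rw [varifoldMass, integral_map measurable_fst.aemeasurable hf.1.aestronglyMeasurable]
  exact hT (fun p => f p.1) (hf.1.comp continuous_fst)
    ((hf.2.isCompact.prod isCompact_univ).of_isClosed_subset (isClosed_tsupport _) hsub)
    (hsub.trans (prod_mono hf.3 subset_rfl))

/-- On compact subsets of `Ω`, the mass of `v(M, θ)` is `θ ℋᵈ|_M`. -/
theorem IsRectifiableVarifold.mass_restrict (hV : IsRectifiableVarifold Ω M θ V) (hΩ : IsOpen Ω)
    {K : Set (Euc n)} (hK : IsCompact K) (hKΩ : K ⊆ Ω) :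
    (varifoldMass V).restrict K =
      ((μHE[d] : Measure (Euc n)).restrict (K ∩ M)).withDensity fun x => ENNReal.ofReal (θ x) := by
  obtain ⟨χ, hχ1, hχc, hχΩ, hχ01⟩ :=
    exists_continuousMap_one_of_isCompact_subset_isOpen hK hΩ hKΩ
  set K' := tsupport χ with hK'
  have hK'c : IsCompact K' := hχc
  have hKK' : K ⊆ K' := fun x hx => subset_tsupport χ (by simp [hχ1 hx])
  set m : Measure (Euc n) := (μHE[d] : Measure (Euc n)).restrict (K' ∩ M) with hm
  have hθm : Integrable θ m := by
    have := hV.locallyIntegrable K' hK'c hχΩ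
    rwa [inter_comm] at this
  have hχcont : Continuous fun x => ENNReal.ofReal (χ x) :=
    ENNReal.continuous_ofReal.comp χ.continuous
  -- Weighting by the cutoff makes both measures finite, and turns any bounded continuous `f` into
  -- an admissible test function `χ f`; the weight is `1` on `K`.
  set μ₁ := (varifoldMass V).withDensity fun x => ENNReal.ofReal (χ x) with hμ₁
  set μ₂ := (m.withDensity fun x => ENNReal.ofReal (θ x)).withDensity
    fun x => ENNReal.ofReal (χ x) with hμ₂
  have hχ_int : Integrable χ (varifoldMass V) :=
    IsCcOn.integrable (Ω := Ω) ⟨χ.continuous, hχc, hχΩ⟩ (hV.isVarifold.mass_lt_top hK'c hχΩ)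
  have hfin₁ : IsFiniteMeasure μ₁ := by
    refine isFiniteMeasure_withDensity ?_
    exact hχ_int.lintegral_lt_top.ne
  have hfin₀ : IsFiniteMeasure (m.withDensity fun x => ENNReal.ofReal (θ x)) :=
    isFiniteMeasure_withDensity hθm.lintegral_lt_top.ne
  have hfin₂ : IsFiniteMeasure μ₂ := by
    refine isFiniteMeasure_withDensity (ne_of_lt ?_)
    calc _ ≤ ∫⁻ _, 1 ∂(m.withDensity fun x => ENNReal.ofReal (θ x)) := by
          refine lintegral_mono fun x => ?_
          simpa using (hχ01 x).2
      _ < ⊤ := by simpa using hθm.lintegral_lt_top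
  have heq : μ₁ = μ₂ := by
    refine ext_of_forall_integral_eq_of_IsFiniteMeasure fun f => ?_
    have hfχ : IsCcOn Ω fun x => χ x * f x :=
      ⟨χ.continuous.mul f.continuous, HasCompactSupport.mul_right hχc, (tsupport_mul_subset_left).trans hχΩ⟩
    rw [hμ₁, integral_withDensity_eq_integral_toReal_smul₀ hχcont.measurable.aemeasurable
      (ae_of_all _ fun _ => ENNReal.ofReal_lt_top), hμ₂,
      integral_withDensity_eq_integral_toReal_smul₀ hχcont.measurable.aemeasurable
      (ae_of_all _ fun _ => ENNReal.ofReal_lt_top),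
      integral_withDensity_eq_integral_toReal_smul₀ hθm.1.aemeasurable.ennreal_ofReal
      (ae_of_all _ fun _ => ENNReal.ofReal_lt_top)]
    simp only [smul_eq_mul, ENNReal.toReal_ofReal (hχ01 _).1, ENNReal.toReal_ofReal (hV.nonneg _)]
    rw [hV.integral_mass hfχ, hm, ← Measure.restrict_restrict hK'c.measurableSet,
      ← setIntegral_eq_integral_of_forall_compl_eq_zero (s := K')]
    · refine integral_congr_ae (ae_of_all _ fun x => ?_)
      ring
    · intro x hx
      simp [image_eq_zero_of_notMem_tsupport hx]
  have hone (μ : Measure (Euc n)) :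
      (μ.withDensity fun x => ENNReal.ofReal (χ x)).restrict K = μ.restrict K := by
    rw [restrict_withDensity hK.measurableSet]
    conv_rhs => rw [← withDensity_one (μ := μ.restrict K)]
    refine withDensity_congr_ae ?_
    filter_upwards [ae_restrict_mem hK.measurableSet] with x hx
    simp [hχ1 hx]
  rw [← hone, ← hμ₁, heq, hμ₂, hone, restrict_withDensity hK.measurableSet, hm,
    Measure.restrict_restrict hK.measurableSet, ← inter_assoc, inter_eq_left.mpr hKK']

/-- The mass of a rectifiable varifold has positive upper density almost everywhere. -/
theorem IsRectifiableVarifold.ae_restrict_notMem_zeroDensitySet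
    (hV : IsRectifiableVarifold Ω M θ V) (hΩ : IsOpen Ω) {K : Set (Euc n)} (hK : IsCompact K)
    (hKΩ : K ⊆ Ω) :
    ∀ᵐ x ∂(varifoldMass V).restrict K, x ∉ zeroDensitySet d (varifoldMass V) := by
  set m : Measure (Euc n) := (μHE[d] : Measure (Euc n)).restrict (K ∩ M) with hm
  have hθm : Integrable θ m := by
    have := hV.locallyIntegrable K hK hKΩ
    rwa [inter_comm] at this
  have hKM : NullMeasurableSet (K ∩ M) (μHE[d] : Measure (Euc n)) :=
    hK.measurableSet.nullMeasurableSet.inter hV.rectifiable.nullMeasurable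
  -- Since `θ` is integrable on `K ∩ M`, Markov's inequality gives `E k` finite `ℋᵈ`-measure; since
  -- `θ > 0`, these sets exhaust `‖V‖` on `K`.
  let E (k : ℕ) : Set (Euc n) := {x | 1 / ((k : ℝ) + 1) ≤ θ x} ∩ (K ∩ M)
  have hE (k : ℕ) : μH[d] (E k) < ⊤ := by
    have h1 : m {x | 1 / ((k : ℝ) + 1) ≤ θ x} < ⊤ :=
      hθm.measure_ge_lt_top (by positivity)
    rw [hm, Measure.restrict_apply₀' hKM, Measure.euclideanHausdorffMeasure_def,
      Measure.smul_apply] at h1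
    by_contra htop
    rw [not_lt, top_le_iff] at htop
    change _ • μH[d] (E k) < ⊤ at h1
    rw [htop, ENNReal.smul_def, smul_eq_mul, ENNReal.mul_top] at h1
    · exact lt_irrefl _ h1
    -- The two normalizations of Hausdorff measure differ by a nonzero factor, so finiteness passes
    -- from `μHE` to `μH`.
    · simpa using Measure.addHaarScalarFactor_volume_hausdorffMeasure_ne_zero d
  have hcov : ∀ᵐ x ∂(varifoldMass V).restrict K, ∃ k, x ∈ E k := by
    rw [hV.mass_restrict hΩ hK hKΩ]
    refine (withDensity_absolutelyContinuous _ _).ae_le ?_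
    have hpos : ∀ᵐ x ∂m, 0 < θ x :=
      ae_mono (Measure.restrict_mono inter_subset_right le_rfl) hV.pos
    filter_upwards [hpos, ae_restrict_mem₀ hKM] with x hx hxK
    obtain ⟨k, hk⟩ := exists_nat_one_div_lt hx
    exact ⟨k, hk.le, hxK⟩
  have hnull (k : ℕ) : ∀ᵐ x ∂(varifoldMass V).restrict K,
      ¬ (x ∈ E k ∧ x ∈ zeroDensitySet d (varifoldMass V)) := by
    refine ae_restrict_of_ae ?_
    rw [ae_iff]
    simpa using measure_inter_zeroDensitySet (varifoldMass V) (hE k)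
  filter_upwards [hcov, ae_all_iff.mpr hnull] with x ⟨k, hk⟩ hx hx0
  exact hx k ⟨hk, hx0⟩

theorem IsRectifiableVarifold.ae_notMem_zeroDensitySet (hV : IsRectifiableVarifold Ω M θ V)
    (hΩ : IsOpen Ω) :
    ∀ᵐ x ∂(varifoldMass V), x ∉ zeroDensitySet d (varifoldMass V) := by
  obtain ⟨K, hK, hKΩ, hcov⟩ := exists_compact_exhaustion hΩ
  have h1 : ∀ᵐ x ∂(varifoldMass V), x ∈ Ω := by
    rw [ae_iff]
    exact hV.isVarifold.mass_compl hΩ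
  have h2 (j : ℕ) := (ae_restrict_iff' (hK j).measurableSet).mp
    (hV.ae_restrict_notMem_zeroDensitySet hΩ (hK j) (hKΩ j))
  filter_upwards [h1, ae_all_iff.mpr h2] with x hx hx2
  obtain ⟨j, hj⟩ := mem_iUnion.mp (hcov hx)
  exact hx2 j (interior_subset hj)

theorem mem_zeroDensitySet_of_tendsto {μ : Measure (Euc n)} {x : Euc n} {R : ℝ}
    (hfin : μ (Metric.closedBall x R) ≠ ⊤) (hR : 0 < R)
    (h : Tendsto (fun r => (r ^ d)⁻¹ * μ.real (Metric.ball x r)) (𝓝[>] 0) (𝓝 0)) :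
    x ∈ zeroDensitySet d μ := by
  intro t ht
  have h2 := tendsto_const_mul_nhdsGT_zero two_pos
  filter_upwards [(h.comp h2).eventually (gt_mem_nhds (show 0 < t / 2 ^ d by positivity)),
    Ioo_mem_nhdsGT (show 0 < R / 2 by positivity)] with r hr hrR
  have hr0 : 0 < r := hrR.1
  have hsub : Metric.closedBall x r ⊆ Metric.ball x (2 * r) :=
    Metric.closedBall_subset_ball (by linarith)
  have hbfin : μ (Metric.ball x (2 * r)) ≠ ⊤ :=
    ((measure_mono (Metric.ball_subset_closedBall.trans
      (Metric.closedBall_subset_closedBall (by linarith [hrR.2])))).trans_lt hfin.lt_top).ne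
  refine (measure_mono hsub).trans ?_
  rw [← ENNReal.ofReal_toReal hbfin]
  refine ENNReal.ofReal_le_ofReal ?_
  rw [Function.comp_apply, mul_pow, mul_inv, lt_div_iff₀ (by positivity)] at hr
  have h3 : ((2 : ℝ) ^ d)⁻¹ * (r ^ d)⁻¹ * μ.real (Metric.ball x (2 * r)) * 2 ^ d =
      μ.real (Metric.ball x (2 * r)) / r ^ d := by
    field_simp
  rw [h3, div_lt_iff₀ (by positivity)] at hr
  exact hr.le

end Density

/-! ### Monotonicity formula and existence of the density. -/

section Monotonicity

open scoped ENNReal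

/-- Layer-cake formula: the nonempty superlevel sets of a continuous decreasing function of the
distance are closed balls about `x`, so a comparison on balls integrates. Radius zero can occur. -/
theorem lintegral_antitone_dist_le {X : Type*} [MetricSpace X] [MeasurableSpace X]
    [BorelSpace X] {μ β : Measure X} {x : X} {R : ℝ} {c : ℝ≥0∞} {g : ℝ → ℝ} (hg : Continuous g)
    (hanti : AntitoneOn g (Ici 0)) (hg0 : ∀ v, 0 ≤ g v) (hgR : ∀ v, R ≤ v → g v = 0)
    (h : ∀ a, 0 ≤ a → a ≤ R → β (Metric.closedBall x a) ≤ c * μ (Metric.closedBall x a)) :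
    ∫⁻ y, ENNReal.ofReal (g (dist y x)) ∂β ≤ c * ∫⁻ y, ENNReal.ofReal (g (dist y x)) ∂μ := by
  have hcont : Continuous fun y => g (dist y x) := by fun_prop
  rw [lintegral_eq_lintegral_meas_le β (ae_of_all _ fun y => hg0 _) hcont.measurable.aemeasurable,
    lintegral_eq_lintegral_meas_le μ (ae_of_all _ fun y => hg0 _) hcont.measurable.aemeasurable]
  have hmeas : Measurable fun t : ℝ => μ {y | t ≤ g (dist y x)} :=
    Antitone.measurable fun s t hst => measure_mono fun y hy => hst.trans hy
  rw [← lintegral_const_mul _ hmeas]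
  refine setLIntegral_mono (hmeas.const_mul _) fun t ht => ?_
  set S : Set ℝ := {v | 0 ≤ v ∧ t ≤ g v} with hS
  rcases S.eq_empty_or_nonempty with hemp | hne
  · have : {y | t ≤ g (dist y x)} = ∅ :=
      by
      refine eq_empty_of_forall_notMem fun y hy => ?_
      have h1 : dist y x ∈ S := ⟨dist_nonneg, hy⟩
      simp [hemp] at h1
    simp [this]
  · have hbdd : ∀ v ∈ S, v ≤ R := fun v hv => by
      by_contra hlt
      have h1 := hgR v (not_le.mp hlt).le
      exact absurd (h1 ▸ hv.2) (not_le.mpr ht)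
    have hclosed : IsClosed S :=
      (isClosed_le continuous_const continuous_id).inter (isClosed_le continuous_const hg)
    have ha := hclosed.csSup_mem hne ⟨R, hbdd⟩
    have heq : {y | t ≤ g (dist y x)} = Metric.closedBall x (sSup S) := by
      ext y
      constructor
      · exact fun hy => le_csSup ⟨R, hbdd⟩ ⟨dist_nonneg, hy⟩
      · exact fun hy => ha.2.trans (hanti dist_nonneg ha.1 hy)
    rw [heq]
    exact h _ ha.1 (hbdd _ ha)

/-- Smooth nonincreasing profiles vanishing on `[1, ∞)`. -/
structure IsDecreasingProfile (ψ : ℝ → ℝ) : Prop where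
  contDiff : ContDiff ℝ 1 ψ
  antitone : Antitone ψ
  nonneg : ∀ u, 0 ≤ ψ u
  eq_zero : ∀ u, 1 ≤ u → ψ u = 0

namespace IsDecreasingProfile

variable {ψ : ℝ → ℝ}

theorem deriv_nonpos (hψ : IsDecreasingProfile ψ) (u : ℝ) : deriv ψ u ≤ 0 :=
  hψ.antitone.deriv_nonpos

theorem exists_bound_mul_deriv (hψ : IsDecreasingProfile ψ) :
    ∃ B : ℝ, ∀ u, 0 ≤ u → |u * deriv ψ u| ≤ B := by
  have hc : Continuous fun u => u * deriv ψ u :=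
    continuous_id.mul (hψ.contDiff.continuous_deriv (by simp))
  obtain ⟨B, hB⟩ := isCompact_Icc.exists_bound_of_continuousOn (s := Icc (0 : ℝ) 1) hc.continuousOn
  refine ⟨max B 0, fun u hu => ?_⟩
  rcases le_or_gt u 1 with h | h
  · exact (hB u ⟨hu, h⟩).trans (le_max_left _ _)
  · have : ψ =ᶠ[𝓝 u] fun _ => 0 := by
      filter_upwards [lt_mem_nhds h] with v hv using hψ.eq_zero v hv.le
    rw [this.deriv_eq]
    simp

end IsDecreasingProfile

variable {d n : ℕ} {Ω : Set (Euc n)} {V : Measure (Euc n × Grass d n)} {ψ : ℝ → ℝ}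

/-- Differentiation under the integral: for `s > r / 2` the integrand's derivative is dominated by a
constant, because `u ψ'(u)` is bounded on `[0, ∞)`. The argument `|y - x|²` avoids the singularity
of the norm at `x`. -/
theorem hasDerivAt_integral_profile (hψ : IsDecreasingProfile ψ) (μ : Measure (Euc n))
    [IsFiniteMeasure μ] (x : Euc n) {r : ℝ} (hr : 0 < r) :
    Integrable (fun y => ‖y - x‖ ^ 2 / r ^ 2 * deriv ψ (‖y - x‖ ^ 2 / r ^ 2)) μ ∧
    HasDerivAt (fun s => ∫ y, ψ (‖y - x‖ ^ 2 / s ^ 2) ∂μ)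
      (-(2 / r) * ∫ y, ‖y - x‖ ^ 2 / r ^ 2 * deriv ψ (‖y - x‖ ^ 2 / r ^ 2) ∂μ) r := by
  obtain ⟨B, hB⟩ := hψ.exists_bound_mul_deriv
  have hdc : Continuous (deriv ψ) := hψ.contDiff.continuous_deriv (by simp)
  have hψc := hψ.contDiff.continuous
  have hint : Integrable (fun y => ‖y - x‖ ^ 2 / r ^ 2 * deriv ψ (‖y - x‖ ^ 2 / r ^ 2)) μ :=
    Integrable.of_bound (Continuous.aestronglyMeasurable (by fun_prop)) B
      (ae_of_all _ fun y => hB _ (by positivity))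
  refine ⟨hint, ?_⟩
  rw [← integral_const_mul]
  have hB0 : 0 ≤ B := (abs_nonneg _).trans (hB 0 le_rfl)
  refine (hasDerivAt_integral_of_dominated_loc_of_deriv_le
    (F := fun s y => ψ (‖y - x‖ ^ 2 / s ^ 2))
    (F' := fun s y => -(2 / s) * (‖y - x‖ ^ 2 / s ^ 2 * deriv ψ (‖y - x‖ ^ 2 / s ^ 2)))
    (bound := fun _ => 2 / (r / 2) * B) (s := Ioi (r / 2)) (Ioi_mem_nhds (by linarith))
    (Eventually.of_forall fun s => Continuous.aestronglyMeasurable (by fun_prop)) ?_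
    (Continuous.aestronglyMeasurable (by fun_prop)) (ae_of_all _ fun y s hs => ?_)
    (integrable_const _) (ae_of_all _ fun y s hs => ?_)).2
  · refine Integrable.of_bound (Continuous.aestronglyMeasurable (by fun_prop)) (ψ 0)
      (ae_of_all _ fun y => ?_)
    rw [Real.norm_of_nonneg (hψ.nonneg _)]
    exact hψ.antitone (by positivity)
  · have hs' : r / 2 < s := hs
    have hs0 : 0 < s := by linarith
    rw [norm_mul, norm_neg, Real.norm_of_nonneg (by positivity : 0 ≤ 2 / s)]
    gcongr
    exact hB _ (by positivity)
  · have hs' : r / 2 < s := hs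
    have hs0 : s ≠ 0 := by intro h; linarith
    have h1 : HasDerivAt (fun s : ℝ => ‖y - x‖ ^ 2 / s ^ 2) (-2 * ‖y - x‖ ^ 2 / s ^ 3) s := by
      have h2 := (hasDerivAt_const s (‖y - x‖ ^ 2)).div (hasDerivAt_pow 2 s) (pow_ne_zero 2 hs0)
      refine HasDerivAt.congr_deriv (f := fun s : ℝ => ‖y - x‖ ^ 2 / s ^ 2) h2 ?_
      field_simp
      push_cast
      ring
    have h3 := (hψ.contDiff.differentiable (by simp) (‖y - x‖ ^ 2 / s ^ 2)).hasDerivAt.comp s h1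
    refine HasDerivAt.congr_deriv (f := fun s : ℝ => ψ (‖y - x‖ ^ 2 / s ^ 2)) h3 ?_
    field_simp

/-- The radial test field used for the monotonicity formula. -/
theorem isTestField_radial (hψ : IsDecreasingProfile ψ) {x : Euc n} {r : ℝ} (hr : 0 < r)
    (hΩ : Metric.closedBall x r ⊆ Ω) :
    IsTestField Ω (fun y => ψ (‖y - x‖ ^ 2 / r ^ 2) • (y - x)) ∧
      tsupport (fun y => ψ (‖y - x‖ ^ 2 / r ^ 2) • (y - x)) ⊆ Metric.closedBall x r := by
  have h : tsupport (fun y => ψ (‖y - x‖ ^ 2 / r ^ 2) • (y - x)) ⊆ Metric.closedBall x r := by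
    refine closure_minimal (fun y hy => ?_) Metric.isClosed_closedBall
    by_contra hn
    rw [Metric.mem_closedBall, not_le, dist_eq_norm] at hn
    refine hy ?_
    simp only
    rw [hψ.eq_zero, zero_smul]
    rw [one_le_div (by positivity)]
    gcongr
  refine ⟨⟨?_, (isCompact_closedBall x r).of_isClosed_subset (isClosed_tsupport _) h,
    h.trans hΩ⟩, h⟩
  have h1 : ContDiff ℝ 1 fun y : Euc n => y - x := contDiff_id.sub contDiff_const
  exact (hψ.contDiff.comp ((h1.norm_sq ℝ).div_const _)).smul h1

/-- Since `ψ' ≤ 0`, replacing `⟨P(y-x), y-x⟩` by the larger `|y-x|²` only lowers the divergence. The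
dropped term is the normal part in the classical monotonicity identity. -/
theorem le_firstVariation_radial (hV : IsVarifold Ω V) (hψ : IsDecreasingProfile ψ) {x : Euc n}
    {r R : ℝ} (hr : 0 < r) (hrR : r ≤ R) (hΩ : Metric.closedBall x R ⊆ Ω) :
    ∫ y, (d * ψ (‖y - x‖ ^ 2 / r ^ 2) +
      2 * (‖y - x‖ ^ 2 / r ^ 2 * deriv ψ (‖y - x‖ ^ 2 / r ^ 2)))
        ∂(varifoldMass V).restrict (Metric.closedBall x R) ≤
      firstVariation V fun y => ψ (‖y - x‖ ^ 2 / r ^ 2) • (y - x) := by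
  have hdc : Continuous (deriv ψ) := hψ.contDiff.continuous_deriv (by simp)
  have hψc := hψ.contDiff.continuous
  obtain ⟨hX, -⟩ := isTestField_radial hψ hr ((Metric.closedBall_subset_closedBall hrR).trans hΩ)
  set f : Euc n → ℝ := fun y => d * ψ (‖y - x‖ ^ 2 / r ^ 2) +
      2 * (‖y - x‖ ^ 2 / r ^ 2 * deriv ψ (‖y - x‖ ^ 2 / r ^ 2)) with hf
  have hfc : Continuous f := by fun_prop
  have hf0 : ∀ y, y ∉ Metric.closedBall x R → f y = 0 := fun y hy => by
    rw [Metric.mem_closedBall, not_le, dist_eq_norm] at hy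
    have h1 : 1 < ‖y - x‖ ^ 2 / r ^ 2 := by
      rw [one_lt_div (by positivity)]
      gcongr
      exact hrR.trans_lt hy
    have : ψ =ᶠ[𝓝 (‖y - x‖ ^ 2 / r ^ 2)] fun _ => 0 := by
      filter_upwards [lt_mem_nhds h1] with v hv using hψ.eq_zero v hv.le
    simp only [hf]
    rw [this.deriv_eq, hψ.eq_zero _ h1.le]
    simp
  rw [setIntegral_eq_integral_of_forall_compl_eq_zero hf0, varifoldMass,
    integral_map measurable_fst.aemeasurable hfc.aestronglyMeasurable]
  refine integral_mono (hV.integrable_of_continuous (isCompact_closedBall x R) hΩ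
    (hfc.comp continuous_fst) fun p hp => hf0 _ hp) (hV.integrable_tangentialDiv hX) fun p => ?_
  have hdiff (t : ℝ) : HasDerivAt (fun t => ψ (t / r ^ 2)) (deriv ψ (t / r ^ 2) * (1 / r ^ 2)) t :=
    (hψ.contDiff.differentiable (by simp) (t / r ^ 2)).hasDerivAt.comp t
      ((hasDerivAt_id t).div_const _)
  have h := tangentialDiv_radial p.2 (g := fun t => ψ (t / r ^ 2)) x p.1 (hdiff _).differentiableAt
  simp only at h ⊢
  rw [h, (hdiff _).deriv]
  simp only [hf]
  refine add_le_add le_rfl ?_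
  have h1 := hψ.deriv_nonpos (‖p.1 - x‖ ^ 2 / r ^ 2)
  have h2 := p.2.inner_apply_self_le (p.1 - x)
  have h3 : 0 < r ^ 2 := by positivity
  calc 2 * (‖p.1 - x‖ ^ 2 / r ^ 2 * deriv ψ (‖p.1 - x‖ ^ 2 / r ^ 2))
      = 2 * (deriv ψ (‖p.1 - x‖ ^ 2 / r ^ 2) * (1 / r ^ 2)) * ‖p.1 - x‖ ^ 2 := by ring
    _ ≤ _ := by
      refine mul_le_mul_of_nonpos_left h2 ?_
      have : deriv ψ (‖p.1 - x‖ ^ 2 / r ^ 2) * (1 / r ^ 2) ≤ 0 :=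
        mul_nonpos_of_nonpos_of_nonneg h1 (by positivity)
      linarith

/-- The first variation near `x` is controlled by the mass: it is bounded by a measure whose mass
on balls about `x` is at most `C` times the mass of the varifold. -/
structure IsFirstVariationControlledAt (V : Measure (Euc n × Grass d n)) (Ω : Set (Euc n))
    (x : Euc n) (R C : ℝ) (β : Measure (Euc n)) : Prop where
  pos : 0 < R
  nonneg : 0 ≤ C
  closedBall_subset : Metric.closedBall x R ⊆ Ω
  le_lintegral : ∀ X : Euc n → Euc n, IsTestField Ω X → tsupport X ⊆ Metric.closedBall x R →
    ENNReal.ofReal |firstVariation V X| ≤ ∫⁻ y, ‖X y‖ₑ ∂β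
  measure_le : ∀ a, 0 ≤ a → a ≤ R → β (Metric.closedBall x a) ≤
    ENNReal.ofReal C * varifoldMass V (Metric.closedBall x a)

namespace IsFirstVariationControlledAt

variable {x : Euc n} {R C : ℝ} {β : Measure (Euc n)}

/-- The field has length at most `r ψ`, and `ψ` decreases with the distance to `x`, so the bound of
`β` by `C‖V‖` on balls transfers to the integral. -/
theorem firstVariation_radial_le (hV : IsVarifold Ω V) (hψ : IsDecreasingProfile ψ)
    (h : IsFirstVariationControlledAt V Ω x R C β) {r : ℝ} (hr : 0 < r) (hrR : r ≤ R) :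
    firstVariation V (fun y => ψ (‖y - x‖ ^ 2 / r ^ 2) • (y - x)) ≤
      C * r * ∫ y, ψ (‖y - x‖ ^ 2 / r ^ 2) ∂(varifoldMass V).restrict (Metric.closedBall x R) := by
  have hψc := hψ.contDiff.continuous
  obtain ⟨hX, hXs⟩ := isTestField_radial hψ hr
    ((Metric.closedBall_subset_closedBall hrR).trans h.closedBall_subset)
  have h1 := h.le_lintegral _ hX (hXs.trans (Metric.closedBall_subset_closedBall hrR))
  have hzero : ∀ v, r ≤ v → ψ (v ^ 2 / r ^ 2) = 0 := fun v hv => by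
    refine hψ.eq_zero _ ?_
    rw [one_le_div (by positivity)]
    gcongr
  have hmass : IsFiniteMeasure ((varifoldMass V).restrict (Metric.closedBall x R)) :=
    ⟨by simpa using hV.mass_lt_top (isCompact_closedBall x R) h.closedBall_subset⟩
  have h2 : ∫⁻ y, ‖ψ (‖y - x‖ ^ 2 / r ^ 2) • (y - x)‖ₑ ∂β ≤
      ENNReal.ofReal r * ∫⁻ y, ENNReal.ofReal (ψ (dist y x ^ 2 / r ^ 2)) ∂β := by
    rw [← lintegral_const_mul' _ _ ENNReal.ofReal_ne_top]
    refine lintegral_mono fun y => ?_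
    rw [← ofReal_norm, norm_smul, Real.norm_of_nonneg (hψ.nonneg _),
      ← ENNReal.ofReal_mul hr.le, dist_eq_norm]
    refine ENNReal.ofReal_le_ofReal ?_
    rcases le_or_gt r ‖y - x‖ with hy | hy
    · rw [hzero _ hy]; simp
    · rw [mul_comm]
      exact mul_le_mul_of_nonneg_right hy.le (hψ.nonneg _)
  have h3 : ∫⁻ y, ENNReal.ofReal (ψ (dist y x ^ 2 / r ^ 2)) ∂β ≤ ENNReal.ofReal C *
      ∫⁻ y, ENNReal.ofReal (ψ (dist y x ^ 2 / r ^ 2)) ∂(varifoldMass V) :=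
    lintegral_antitone_dist_le (g := fun v => ψ (v ^ 2 / r ^ 2)) (R := R) (by fun_prop)
      (fun u hu v _ huv => hψ.antitone (by
        have : 0 ≤ u := hu
        gcongr)) (fun v => hψ.nonneg _)
      (fun v hv => hzero v (hrR.trans hv)) h.measure_le
  have h4 : ∫⁻ y, ENNReal.ofReal (ψ (dist y x ^ 2 / r ^ 2)) ∂(varifoldMass V) =
      ENNReal.ofReal (∫ y, ψ (‖y - x‖ ^ 2 / r ^ 2)
        ∂(varifoldMass V).restrict (Metric.closedBall x R)) := by
    rw [ofReal_integral_eq_lintegral_ofReal]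
    · simp_rw [← dist_eq_norm]
      rw [setLIntegral_eq_of_support_subset]
      refine Function.support_subset_iff'.mpr fun y hy => ?_
      rw [Metric.mem_closedBall, not_le] at hy
      rw [hzero _ (hrR.trans hy.le), ENNReal.ofReal_zero]
    · refine Integrable.of_bound (Continuous.aestronglyMeasurable (by fun_prop)) (ψ 0)
        (ae_of_all _ fun y => ?_)
      rw [Real.norm_of_nonneg (hψ.nonneg _)]
      exact hψ.antitone (by positivity)
    · exact ae_of_all _ fun y => hψ.nonneg _
  have h5 := h1.trans (h2.trans (mul_le_mul_right (h3.trans_eq (congrArg _ h4)) _))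
  have hI : 0 ≤ ∫ y, ψ (‖y - x‖ ^ 2 / r ^ 2)
      ∂(varifoldMass V).restrict (Metric.closedBall x R) := integral_nonneg fun y => hψ.nonneg _
  rw [← ENNReal.ofReal_mul h.nonneg, ← ENNReal.ofReal_mul hr.le,
    ENNReal.ofReal_le_ofReal_iff (mul_nonneg hr.le (mul_nonneg h.nonneg hI))] at h5
  linarith [le_abs_self (firstVariation V fun y => ψ (‖y - x‖ ^ 2 / r ^ 2) • (y - x))]

/-- With `I` the integral and `J` that of `u ψ'(u)`, the two preceding estimates give `d I + 2 J ≤ C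
r I`. The derivative is a positive factor times `C r I - (d I + 2 J)`. -/
theorem monotoneOn_integral (hV : IsVarifold Ω V) (hψ : IsDecreasingProfile ψ)
    (h : IsFirstVariationControlledAt V Ω x R C β) :
    MonotoneOn (fun r => Real.exp (C * r) * (r ^ d)⁻¹ *
      ∫ y, ψ (‖y - x‖ ^ 2 / r ^ 2) ∂(varifoldMass V).restrict (Metric.closedBall x R))
      (Ioo 0 R) := by
  have hψc := hψ.contDiff.continuous
  have hmass : IsFiniteMeasure ((varifoldMass V).restrict (Metric.closedBall x R)) :=
    ⟨by simpa using hV.mass_lt_top (isCompact_closedBall x R) h.closedBall_subset⟩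
  set μ := (varifoldMass V).restrict (Metric.closedBall x R) with hμ
  have hderiv (r : ℝ) (hr : 0 < r) := by
    have h1 := (hasDerivAt_integral_profile hψ μ x hr).2
    have h2 : HasDerivAt (fun r => Real.exp (C * r)) (Real.exp (C * r) * C) r := by
      simpa using ((hasDerivAt_id r).const_mul C).exp
    have h3 : HasDerivAt (fun r : ℝ => (r ^ d)⁻¹) (-(d * r ^ (d - 1)) / (r ^ d) ^ 2) r :=
      (hasDerivAt_pow d r).inv (pow_ne_zero d hr.ne')
    exact (h2.mul h3).mul h1
  refine monotoneOn_of_deriv_nonneg (convex_Ioo 0 R)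
    (fun r hr => (hderiv r hr.1).continuousAt.continuousWithinAt) (fun r hr => ?_) fun r hr => ?_
  · rw [interior_Ioo] at hr
    exact (hderiv r hr.1).differentiableAt.differentiableWithinAt
  · rw [interior_Ioo] at hr
    have hr0 := hr.1
    have h1 := (le_firstVariation_radial hV hψ hr0 hr.2.le h.closedBall_subset).trans
      (h.firstVariation_radial_le hV hψ hr0 hr.2.le)
    have hint : Integrable (fun y => ψ (‖y - x‖ ^ 2 / r ^ 2)) μ := by
      refine Integrable.of_bound (Continuous.aestronglyMeasurable (by fun_prop)) (ψ 0)
        (ae_of_all _ fun y => ?_)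
      rw [Real.norm_of_nonneg (hψ.nonneg _)]
      exact hψ.antitone (by positivity)
    rw [← hμ, integral_add (hint.const_mul _)
      ((hasDerivAt_integral_profile hψ μ x hr0).1.const_mul _), integral_const_mul,
      integral_const_mul] at h1
    erw [(hderiv r hr0).deriv]
    set I := ∫ y, ψ (‖y - x‖ ^ 2 / r ^ 2) ∂μ
    set J := ∫ y, ‖y - x‖ ^ 2 / r ^ 2 * deriv ψ (‖y - x‖ ^ 2 / r ^ 2) ∂μ
    -- The subtraction `d - 1` is truncated, hence the separate case `d = 0`.
    have hpow : (d : ℝ) * r ^ (d - 1) = d * r ^ d / r := by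
      rcases Nat.eq_zero_or_pos d with h0 | h0
      · simp [h0]
      · rw [eq_div_iff hr0.ne', mul_assoc, ← pow_succ, Nat.sub_add_cancel h0]
    have key : (Real.exp (C * r) * C * (r ^ d)⁻¹ +
        Real.exp (C * r) * (-(d * r ^ (d - 1)) / (r ^ d) ^ 2)) * I +
        Real.exp (C * r) * (r ^ d)⁻¹ * (-(2 / r) * J) =
        Real.exp (C * r) * (r ^ d)⁻¹ / r * (C * r * I - (d * I + 2 * J)) := by
      rw [hpow]
      have : r ^ d ≠ 0 := pow_ne_zero d hr0.ne'
      field_simp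
      ring
    refine le_of_le_of_eq ?_ key.symm
    exact mul_nonneg (by positivity) (sub_nonneg.mpr h1)

theorem isDecreasingProfile_smoothTransition (k : ℕ) :
    IsDecreasingProfile fun u => Real.smoothTransition (k * (1 - u)) where
  contDiff := (Real.smoothTransition.contDiff (n := 1)).comp
    (contDiff_const.mul (contDiff_const.sub contDiff_id))
  antitone u v huv := Real.smoothTransition.monotone (by gcongr)
  nonneg u := Real.smoothTransition.nonneg _
  eq_zero u hu := Real.smoothTransition.zero_of_nonpos
    (mul_nonpos_of_nonneg_of_nonpos (by positivity) (by linarith))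

/-- The profiles tend to `1` for `u < 1` and vanish for `u ≥ 1`, so the limit is the indicator of
the open ball. Monotonicity thereby passes from smooth profiles to balls. -/
theorem tendsto_integral_smoothTransition (μ : Measure (Euc n)) [IsFiniteMeasure μ] (x : Euc n)
    {r : ℝ} (hr : 0 < r) :
    Tendsto (fun k : ℕ => ∫ y, Real.smoothTransition (k * (1 - ‖y - x‖ ^ 2 / r ^ 2)) ∂μ) atTop
      (𝓝 (μ.real (Metric.ball x r))) := by
  have h1 : μ.real (Metric.ball x r) = ∫ y, (Metric.ball x r).indicator (fun _ => (1 : ℝ)) y ∂μ := by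
    rw [integral_indicator Metric.isOpen_ball.measurableSet]
    simp
  rw [h1]
  have hc := Real.smoothTransition.continuous
  refine tendsto_integral_of_dominated_convergence (fun _ => 1)
    (fun k => Continuous.aestronglyMeasurable (by fun_prop)) (integrable_const _)
    (fun k => ae_of_all _ fun y => ?_) (ae_of_all _ fun y => ?_)
  · rw [Real.norm_of_nonneg (Real.smoothTransition.nonneg _)]
    exact Real.smoothTransition.le_one _
  · by_cases hy : y ∈ Metric.ball x r
    · rw [indicator_of_mem hy]
      rw [Metric.mem_ball, dist_eq_norm] at hy
      have h2 : 0 < 1 - ‖y - x‖ ^ 2 / r ^ 2 := by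
        rw [sub_pos, div_lt_one (by positivity)]
        gcongr
      refine tendsto_const_nhds.congr' ?_
      have h3 : Tendsto (fun k : ℕ => (k : ℝ) * (1 - ‖y - x‖ ^ 2 / r ^ 2)) atTop atTop :=
        tendsto_natCast_atTop_atTop.atTop_mul_const h2
      filter_upwards [h3.eventually_ge_atTop 1] with k hk
      exact (Real.smoothTransition.one_of_one_le hk).symm
    · rw [indicator_of_notMem hy]
      rw [Metric.mem_ball, dist_eq_norm, not_lt] at hy
      have h2 : 1 ≤ ‖y - x‖ ^ 2 / r ^ 2 := by
        rw [one_le_div (by positivity)]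
        gcongr
      simp_rw [(isDecreasingProfile_smoothTransition _).eq_zero _ h2]
      exact tendsto_const_nhds

/-- The monotonicity formula: the density exists. -/
theorem exists_tendsto_density (hV : IsVarifold Ω V)
    (h : IsFirstVariationControlledAt V Ω x R C β) :
    ∃ Θ : ℝ, 0 ≤ Θ ∧ Tendsto (fun r => (r ^ d)⁻¹ * (varifoldMass V).real (Metric.ball x r))
      (𝓝[>] 0) (𝓝 Θ) := by
  have hmass : IsFiniteMeasure ((varifoldMass V).restrict (Metric.closedBall x R)) :=
    ⟨by simpa using hV.mass_lt_top (isCompact_closedBall x R) h.closedBall_subset⟩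
  set f : ℝ → ℝ := fun r => Real.exp (C * r) * (r ^ d)⁻¹ *
    (varifoldMass V).real (Metric.ball x r) with hf
  have hball (r : ℝ) (hr : r < R) :
      ((varifoldMass V).restrict (Metric.closedBall x R)).real (Metric.ball x r) =
        (varifoldMass V).real (Metric.ball x r) := by
    rw [measureReal_restrict_apply Metric.isOpen_ball.measurableSet, inter_eq_left.mpr]
    exact Metric.ball_subset_closedBall.trans (Metric.closedBall_subset_closedBall hr.le)
  have hlim (r : ℝ) (hr : r ∈ Ioo 0 R) := by
    have h1 := (tendsto_integral_smoothTransition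
      ((varifoldMass V).restrict (Metric.closedBall x R)) x hr.1).const_mul
        (Real.exp (C * r) * (r ^ d)⁻¹)
    rw [hball r hr.2] at h1
    exact h1
  have hmono : MonotoneOn f (Ioo 0 R) := fun r hr s hs hrs =>
    le_of_tendsto_of_tendsto' (hlim r hr) (hlim s hs) fun k =>
      h.monotoneOn_integral hV (isDecreasingProfile_smoothTransition k) hr hs hrs
  have hf0 (r : ℝ) (hr : 0 < r) : 0 ≤ f r := by positivity
  have htend := hmono.tendsto_nhdsWithin_Ioo_right (nonempty_Ioo.mpr h.pos)
    ⟨0, by rintro _ ⟨r, hr, rfl⟩; exact hf0 r hr.1⟩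
  refine ⟨_, ge_of_tendsto htend (eventually_mem_nhdsWithin.mono hf0), ?_⟩
  -- The monotone quantity has a limit at `0⁺`; its exponential factor tends to `1` and can be
  -- removed.
  have hexp : Tendsto (fun r => Real.exp (-(C * r))) (𝓝[>] 0) (𝓝 1) := by
    have : Continuous fun r => Real.exp (-(C * r)) := by fun_prop
    simpa using (this.tendsto 0).mono_left nhdsWithin_le_nhds
  have h2 := hexp.mul htend
  rw [one_mul] at h2
  refine h2.congr fun r => ?_
  rw [hf, ← mul_assoc, ← mul_assoc, ← Real.exp_add]
  simp

end IsFirstVariationControlledAt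

end Monotonicity

/-! ### Radial kernels at a point of given density. -/

section Kernel

variable {d n : ℕ}

/-- Evenness forces `k'(0) = 0`, which removes the singularity of the norm at the origin. -/
theorem contDiff_comp_norm_of_even {k : ℝ → ℝ} (hk : ContDiff ℝ 1 k) (heven : ∀ t, k (-t) = k t) :
    ContDiff ℝ 1 fun z : Euc n => k ‖z‖ := by
  have hdk : ∀ t, HasDerivAt k (deriv k t) t := fun t =>
    (hk.differentiable (by simp) t).hasDerivAt
  have hdc : Continuous (deriv k) := hk.continuous_deriv (by simp)
  have hd0 : deriv k 0 = 0 := by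
    have h1 : HasDerivAt (fun t => k (-t)) (-deriv k 0) 0 := by
      have h2 := (hdk (-0)).scomp (0 : ℝ) (hasDerivAt_neg (0 : ℝ))
      rw [neg_zero, neg_one_smul] at h2
      exact h2
    simp_rw [heven] at h1
    linarith [h1.unique (hdk 0)]
  rw [contDiff_one_iff_hasFDerivAt]
  -- At `z = 0` the convention `0⁻¹ = 0` makes this the zero map, which is the correct derivative
  -- there.
  refine ⟨fun z => (deriv k ‖z‖ * ‖z‖⁻¹) • innerSL ℝ z, ?_, fun z => ?_⟩
  · rw [continuous_iff_continuousAt]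
    intro z
    rcases eq_or_ne z 0 with rfl | hz
    · have h1 : Tendsto (fun z : Euc n => |deriv k ‖z‖|) (𝓝 0) (𝓝 0) := by
        have h2 : Continuous fun z : Euc n => |deriv k ‖z‖| := by fun_prop
        simpa [hd0] using h2.tendsto 0
      rw [ContinuousAt]
      simp only [norm_zero, inv_zero, mul_zero, zero_smul]
      refine squeeze_zero_norm (fun y => ?_) h1
      rw [norm_smul, innerSL_apply_norm, norm_mul, norm_inv, norm_norm, Real.norm_eq_abs, mul_assoc]
      refine mul_le_of_le_one_right (abs_nonneg _) ?_
      rcases eq_or_ne y 0 with rfl | hy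
      · simp
      · rw [inv_mul_cancel₀ (norm_ne_zero_iff.mpr hy)]
    · have hz' : ‖z‖ ≠ 0 := norm_ne_zero_iff.mpr hz
      have h1 : ContinuousAt (fun z : Euc n => deriv k ‖z‖ * ‖z‖⁻¹) z :=
        (hdc.comp continuous_norm).continuousAt.mul (continuous_norm.continuousAt.inv₀ hz')
      exact h1.smul (innerSL ℝ).continuous.continuousAt
  · rcases eq_or_ne z 0 with rfl | hz
    · have h1 := (hdk 0)
      rw [hd0, hasDerivAt_iff_isLittleO] at h1
      rw [hasFDerivAt_iff_isLittleO]
      have h2 : Tendsto (fun y : Euc n => ‖y‖) (𝓝 0) (𝓝 0) := by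
        simpa using continuous_norm.tendsto (0 : Euc n)
      have h3 := h1.comp_tendsto h2
      refine Asymptotics.IsLittleO.of_norm_right ?_
      simpa [Function.comp_def] using h3
    · have hz' : ‖z‖ ≠ 0 := norm_ne_zero_iff.mpr hz
      have h1 : HasFDerivAt (fun z : Euc n => ‖z‖ ^ 2) (2 • innerSL ℝ z) z := by
        simpa using (hasFDerivAt_id z).norm_sq
      have h2 := h1.sqrt (by positivity)
      simp only [Real.sqrt_sq (norm_nonneg _)] at h2
      have h3 := (hdk ‖z‖).comp_hasFDerivAt z h2
      refine HasFDerivAt.congr_fderiv (f := fun z : Euc n => k ‖z‖) h3 ?_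
      ext v
      simp
      field_simp

theorem eq_zero_of_one_le {k : ℝ → ℝ} (hk : Continuous k) (hs : tsupport k ⊆ Icc (-1) 1) {t : ℝ}
    (ht : 1 ≤ t) : k t = 0 := by
  have h1 : ∀ s ∈ Ioi (1 : ℝ), k s = 0 := fun s hs' =>
    image_eq_zero_of_notMem_tsupport fun h => absurd (hs h).2 (not_le.mpr hs')
  have h2 : IsClosed {s | k s = 0} := isClosed_eq hk continuous_const
  have h3 : closure (Ioi (1 : ℝ)) ⊆ {s | k s = 0} := closure_minimal h1 h2
  rw [closure_Ioi] at h3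
  exact h3 ht

/-- Polar coordinates in `ℝᵈ`. In this form `C_k` is the kernel integral over a flat plane, to be
compared with the one for `‖V‖`. -/
theorem integral_comp_norm_eq {k : ℝ → ℝ} (hd : 1 ≤ d) (h1 : ∀ t, 1 ≤ t → k t = 0) :
    ∫ z : Euc d, k ‖z‖ = kernelConst d k := by
  have : Nonempty (Fin d) := ⟨⟨0, hd⟩⟩
  rw [integral_fun_norm_addHaar, kernelConst, finrank_euclideanSpace_fin,
    intervalIntegral.integral_of_le zero_le_one,
    setIntegral_eq_of_subset_of_forall_sdiff_eq_zero measurableSet_Ioi Ioc_subset_Ioi_self]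
  · simp only [smul_eq_mul, nsmul_eq_mul, mul_comm (k _), mul_assoc]
    rfl
  · rintro t ⟨ht0, ht1⟩
    have : 1 < t := by
      by_contra h
      exact ht1 ⟨ht0, not_lt.mp h⟩
    simp [h1 t this.le]

theorem kernelConst_pos {k : ℝ → ℝ} (hk : Continuous k) (hprof : IsKernelProfile n k)
    (hd : 1 ≤ d) : 0 < kernelConst d k := by
  have hone : ∀ t, 1 ≤ t → k t = 0 := fun t => eq_zero_of_one_le hk hprof.tsupport_subset
  obtain ⟨z, hz⟩ : ∃ z : Euc n, k ‖z‖ ≠ 0 := by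
    by_contra! h
    have := hprof.integral_eq_one
    simp [h] at this
  rw [← integral_comp_norm_eq hd hone]
  have hc : Continuous fun z : Euc d => k ‖z‖ := by fun_prop
  have hsupp : HasCompactSupport fun z : Euc d => k ‖z‖ := by
    refine HasCompactSupport.intro (isCompact_closedBall (0 : Euc d) 1) fun y hy => ?_
    rw [Metric.mem_closedBall, not_le, dist_zero_right] at hy
    exact hone _ hy.le
  -- The normalization is over `ℝⁿ` while the constant is an integral over `ℝᵈ`: a radius where `k`
  -- is nonzero is carried over by a vector of the same length.
  refine hc.integral_pos_of_hasCompactSupport_nonneg_nonzero hsupp (fun z => hprof.nonneg _)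
    (x := EuclideanSpace.single ⟨0, hd⟩ ‖z‖) ?_
  simpa using hz

/-- On each layer `i/N ≤ u < (i+1)/N` the function `k ∘ u` differs from `k(i/N)` by at most `δ`;
induction adds one layer at a time. The function `u` is general so that the estimate serves both for
`‖V‖` and for Lebesgue measure on `ℝᵈ`. -/
theorem abs_integral_sub_sum_le {X : Type*} [MeasurableSpace X] {μ : Measure X} {u : X → ℝ}
    (hu : Measurable u) (hu0 : ∀ y, 0 ≤ u y) {k : ℝ → ℝ} (hk : Continuous k) {δ : ℝ} {N : ℕ}
    (hN : 0 < N) (hδ : ∀ s t : ℝ, |s - t| ≤ 1 / (N : ℝ) → |k s - k t| ≤ δ) {j : ℕ}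
    (hfin : μ {y | u y < j / N} ≠ ⊤) :
    |∫ y in {y | u y < j / N}, k (u y) ∂μ -
      ∑ i ∈ Finset.range j, k (i / N) * (μ.real {y | u y < (i + 1 : ℕ) / N} -
        μ.real {y | u y < i / N})| ≤ δ * μ.real {y | u y < j / N} := by
  have hN' : (0 : ℝ) < N := by exact_mod_cast hN
  induction j with
  | zero =>
    have : {y | u y < (0 : ℕ) / N} = ∅ := by
      refine eq_empty_of_forall_notMem fun y hy => ?_
      have hy' : u y < (0 : ℕ) / N := hy
      simp only [Nat.cast_zero, zero_div] at hy'
      exact absurd (hu0 y) (not_le.mpr hy')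
    rw [this]
    simp
  | succ j ih =>
    set A : Set X := {y | u y < j / N} with hA
    set B : Set X := {y | u y < (j + 1 : ℕ) / N} with hB
    have hAB : A ⊆ B := fun y hy => lt_of_lt_of_le (show u y < j / N from hy) (by gcongr; omega)
    have hAm : MeasurableSet A := measurableSet_lt hu measurable_const
    have hBm : MeasurableSet B := measurableSet_lt hu measurable_const
    have hAfin : μ A ≠ ⊤ := ((measure_mono hAB).trans_lt hfin.lt_top).ne
    have hint : IntegrableOn (fun y => k (u y)) B μ := by
      obtain ⟨c, hc⟩ := isCompact_Icc.exists_bound_of_continuousOn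
        (s := Icc (0 : ℝ) ((j + 1 : ℕ) / N)) hk.continuousOn
      refine IntegrableOn.of_bound hfin.lt_top (hk.measurable.comp hu).aestronglyMeasurable c ?_
      filter_upwards [ae_restrict_mem hBm] with y hy
      exact hc _ ⟨hu0 y, (show u y < _ from hy).le⟩
    have hsplit : ∫ y in B, k (u y) ∂μ = ∫ y in A, k (u y) ∂μ + ∫ y in B \ A, k (u y) ∂μ := by
      rw [← setIntegral_union disjoint_sdiff_right (hBm.diff hAm) (hint.mono_set hAB)
        (hint.mono_set sdiff_subset), union_sdiff_cancel hAB]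
    have hdiff : μ.real (B \ A) = μ.real B - μ.real A :=
      measureReal_sdiff hAB hAm hfin
    have hBAfin : μ (B \ A) < ⊤ := (measure_mono sdiff_subset).trans_lt hfin.lt_top
    have hlast : |∫ y in B \ A, k (u y) ∂μ - k (j / N) * μ.real (B \ A)| ≤
        δ * μ.real (B \ A) := by
      have hc : ∫ y in B \ A, k (j / N) ∂μ = k (j / N) * μ.real (B \ A) := by
        simp [mul_comm]
      rw [← hc, ← integral_sub (hint.mono_set sdiff_subset) (integrableOn_const (C := k (j / N)) hBAfin.ne enorm_ne_top)]
      refine norm_setIntegral_le_of_norm_le_const (f := fun y => k (u y) - k (j / N)) hBAfin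
        fun y hy => hδ (u y) (j / N) ?_
      have h1 : u y < (j + 1 : ℕ) / N := hy.1
      have h2 : j / N ≤ u y := not_lt.mp hy.2
      rw [abs_of_nonneg (by linarith)]
      push_cast at h1
      rw [add_div] at h1
      linarith
    have hih := ih hAfin
    rw [Finset.sum_range_succ, hsplit, ← hdiff]
    calc _ = |(∫ y in A, k (u y) ∂μ - ∑ i ∈ Finset.range j, k (i / N) *
            (μ.real {y | u y < (i + 1 : ℕ) / N} - μ.real {y | u y < i / N})) +
          (∫ y in B \ A, k (u y) ∂μ - k (j / N) * μ.real (B \ A))| := by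
          congr 1
          ring
      _ ≤ δ * μ.real A + δ * μ.real (B \ A) := (abs_add_le _ _).trans (add_le_add hih hlast)
      _ = δ * μ.real B := by rw [hdiff]; ring

theorem abs_integral_comp_sub_sum_le {X : Type*} [MeasurableSpace X] {μ : Measure X} {u : X → ℝ}
    (hu : Measurable u) (hu0 : ∀ y, 0 ≤ u y) {k : ℝ → ℝ} (hk : Continuous k)
    (h1 : ∀ t, 1 ≤ t → k t = 0) {δ : ℝ} {N : ℕ}
    (hN : 0 < N) (hδ : ∀ s t : ℝ, |s - t| ≤ 1 / (N : ℝ) → |k s - k t| ≤ δ) (hfin : μ {y | u y < 1} ≠ ⊤) :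
    |∫ y, k (u y) ∂μ -
      ∑ i ∈ Finset.range N, k (i / N) * (μ.real {y | u y < (i + 1 : ℕ) / N} -
        μ.real {y | u y < i / N})| ≤ δ * μ.real {y | u y < 1} := by
  have hN' : (N : ℝ) ≠ 0 := by exact_mod_cast hN.ne'
  have h := abs_integral_sub_sum_le hu hu0 hk hN hδ (μ := μ) (j := N) (by rwa [div_self hN'])
  rw [div_self hN', setIntegral_eq_integral_of_forall_compl_eq_zero] at h
  · exact h
  · exact fun y hy => h1 _ (not_lt.mp hy)

/-- If `μ` has density `Θ` at `x`, the averages of radial kernels converge. -/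
theorem tendsto_integral_radial {μ : Measure (Euc n)} {x : Euc n} {R Θ : ℝ} (hd : 1 ≤ d)
    (hR : 0 < R) (hfin : μ (Metric.ball x R) ≠ ⊤)
    (hΘ : Tendsto (fun r => (r ^ d)⁻¹ * μ.real (Metric.ball x r)) (𝓝[>] 0) (𝓝 Θ))
    {k : ℝ → ℝ} (hk : Continuous k) (hs : tsupport k ⊆ Icc (-1) 1) :
    Tendsto (fun ε => (ε ^ d)⁻¹ * ∫ y, k (‖y - x‖ / ε) ∂μ) (𝓝[>] 0)
      (𝓝 (Θ / (volume : Measure (Euc d)).real (Metric.ball 0 1) * kernelConst d k)) := by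
  have hone : ∀ t, 1 ≤ t → k t = 0 := fun t => eq_zero_of_one_le hk hs
  have hcs : HasCompactSupport k := isCompact_Icc.of_isClosed_subset (isClosed_tsupport _) hs
  have huc := hcs.uniformContinuous_of_continuous hk
  have : Nonempty (Fin d) := ⟨⟨0, hd⟩⟩
  set ω := (volume : Measure (Euc d)).real (Metric.ball 0 1) with hω
  have hω0 : 0 < ω := ENNReal.toReal_pos (Metric.measure_ball_pos _ _ one_pos).ne'
    measure_ball_lt_top.ne
  have hΘ0 : 0 ≤ Θ := ge_of_tendsto hΘ (eventually_mem_nhdsWithin.mono fun r hr => by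
    have : (0 : ℝ) < r := hr
    positivity)
  rw [← integral_comp_norm_eq hd hone, Metric.tendsto_nhds]
  intro η hη
  -- One third of `η` for each error: discretizing the integral for `μ`, convergence of the finite
  -- sum, and discretizing the integral over `ℝᵈ`. For small `ε`, `Θ + 1` bounds `ε⁻ᵈ μ(B(x,ε))`.
  set δ : ℝ := η / (3 * (Θ + 1)) with hδdef
  have hδ : 0 < δ := by positivity
  obtain ⟨τ, hτ, hτk⟩ := Metric.uniformContinuous_iff.mp huc δ hδ
  obtain ⟨N', hN'⟩ := exists_nat_one_div_lt hτ
  set N : ℕ := N' + 1 with hNdef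
  have hN : 0 < N := Nat.succ_pos _
  have hNr : (0 : ℝ) < N := by exact_mod_cast hN
  have hmod : ∀ s t : ℝ, |s - t| ≤ 1 / (N : ℝ) → |k s - k t| ≤ δ := fun s t hst =>
    (hτk (lt_of_le_of_lt hst (by push_cast [hNdef]; exact hN'))).le
  have hvol (a : ℝ) (ha : 0 ≤ a) : (volume : Measure (Euc d)).real {z | ‖z‖ < a} = a ^ d * ω := by
    have : {z : Euc d | ‖z‖ < a} = Metric.ball 0 a := by ext; simp
    rw [this, measureReal_def, Measure.addHaar_ball _ _ ha, ENNReal.toReal_mul,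
      ENNReal.toReal_ofReal (by positivity), finrank_euclideanSpace_fin]
    rfl
  have h0 := abs_integral_comp_sub_sum_le (μ := (volume : Measure (Euc d))) (u := fun z => ‖z‖)
    measurable_norm (fun _ => norm_nonneg _) hk hone hN hmod (by
      have : {z : Euc d | ‖z‖ < 1} = Metric.ball 0 1 := by ext; simp
      rw [this]
      exact measure_ball_lt_top.ne)
  rw [hvol 1 zero_le_one, one_pow, one_mul] at h0
  have hset (ε : ℝ) (hε : 0 < ε) (a : ℝ) : {y | ‖y - x‖ / ε < a} = Metric.ball x (ε * a) := by
    ext y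
    simp [div_lt_iff₀ hε, dist_eq_norm, mul_comm]
  have hscale (a : ℝ) (ha : 0 ≤ a) : Tendsto (fun ε => (ε ^ d)⁻¹ * μ.real {y | ‖y - x‖ / ε < a})
      (𝓝[>] 0) (𝓝 (Θ * a ^ d)) := by
    rcases ha.eq_or_lt with rfl | ha
    · rw [zero_pow (by omega), mul_zero]
      refine tendsto_const_nhds.congr' (eventually_mem_nhdsWithin.mono fun ε hε => ?_)
      simp only
      rw [hset ε hε]
      simp
    · have h1 := tendsto_const_mul_nhdsGT_zero ha
      refine ((hΘ.comp h1).mul_const (a ^ d)).congr' ?_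
      filter_upwards [eventually_mem_nhdsWithin] with ε hε
      have hε' : (0 : ℝ) < ε := hε
      rw [hset ε hε', Function.comp_apply, mul_comm a, mul_pow]
      field_simp
  have hsum : Tendsto (fun ε => ∑ i ∈ Finset.range N, k (i / N) *
      ((ε ^ d)⁻¹ * μ.real {y | ‖y - x‖ / ε < (i + 1 : ℕ) / N} -
        (ε ^ d)⁻¹ * μ.real {y | ‖y - x‖ / ε < i / N})) (𝓝[>] 0)
      (𝓝 (∑ i ∈ Finset.range N, k (i / N) * (Θ * ((i + 1 : ℕ) / N) ^ d - Θ * (i / N) ^ d))) :=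
    tendsto_finsetSum _ fun i _ => ((hscale _ (by positivity)).sub
      (hscale _ (by positivity))).const_mul _
  -- As balls in `ℝᵈ` have volume `ω aᵈ`, the limiting sum is `Θ/ω` times the corresponding sum for
  -- Lebesgue measure.
  have hsum0 : ∑ i ∈ Finset.range N, k (i / N) * (Θ * ((i + 1 : ℕ) / N) ^ d - Θ * (i / N) ^ d) =
      Θ / ω * ∑ i ∈ Finset.range N, k (i / N) *
        ((volume : Measure (Euc d)).real {z | ‖z‖ < (i + 1 : ℕ) / N} -
          (volume : Measure (Euc d)).real {z | ‖z‖ < i / N}) := by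
    rw [Finset.mul_sum]
    refine Finset.sum_congr rfl fun i _ => ?_
    rw [hvol _ (by positivity), hvol _ (by positivity)]
    field_simp
  filter_upwards [Metric.tendsto_nhds.mp hsum (η / 3) (by positivity),
    (hscale 1 zero_le_one).eventually (gt_mem_nhds (show Θ * 1 ^ d < Θ + 1 by simp)),
    Ioo_mem_nhdsGT hR] with ε h2 h3 hε
  have hε0 := hε.1
  have h4 := abs_integral_comp_sub_sum_le (μ := μ) (u := fun y => ‖y - x‖ / ε) (by fun_prop)
    (fun _ => by positivity) hk hone hN hmod (by
      rw [hset ε hε0, mul_one]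
      exact ((measure_mono (Metric.ball_subset_ball hε.2.le)).trans_lt hfin.lt_top).ne)
  have h5 : |(ε ^ d)⁻¹ * ∫ y, k (‖y - x‖ / ε) ∂μ - ∑ i ∈ Finset.range N, k (i / N) *
      ((ε ^ d)⁻¹ * μ.real {y | ‖y - x‖ / ε < (i + 1 : ℕ) / N} -
        (ε ^ d)⁻¹ * μ.real {y | ‖y - x‖ / ε < i / N})| ≤ η / 3 := by
    calc _ = (ε ^ d)⁻¹ * |∫ y, k (‖y - x‖ / ε) ∂μ - ∑ i ∈ Finset.range N, k (i / N) *
          (μ.real {y | ‖y - x‖ / ε < (i + 1 : ℕ) / N} - μ.real {y | ‖y - x‖ / ε < i / N})| := by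
          rw [← abs_of_pos (show 0 < (ε ^ d)⁻¹ by positivity), ← abs_mul, mul_sub, Finset.mul_sum,
            abs_of_pos (show 0 < (ε ^ d)⁻¹ by positivity)]
          congr 3
          ext i
          ring
      _ ≤ (ε ^ d)⁻¹ * (δ * μ.real {y | ‖y - x‖ / ε < 1}) := by gcongr
      _ = δ * ((ε ^ d)⁻¹ * μ.real {y | ‖y - x‖ / ε < 1}) := by ring
      _ ≤ δ * (Θ + 1) := by gcongr
      _ = η / 3 := by rw [hδdef]; field_simp
  have h6 : |∑ i ∈ Finset.range N, k (i / N) * (Θ * ((i + 1 : ℕ) / N) ^ d - Θ * (i / N) ^ d) -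
      Θ / ω * ∫ z : Euc d, k ‖z‖| ≤ η / 3 := by
    rw [hsum0, ← mul_sub, abs_mul, abs_of_nonneg (by positivity), abs_sub_comm]
    calc _ ≤ Θ / ω * (δ * ω) := by gcongr
      _ = δ * Θ := by field_simp
      _ ≤ δ * (Θ + 1) := by gcongr; linarith
      _ = η / 3 := by rw [hδdef]; field_simp
  rw [Real.dist_eq] at h2 ⊢
  rw [abs_lt] at h2
  rw [abs_le] at h5 h6
  rw [abs_lt]
  constructor <;> linarith [h2.1, h2.2, h5.1, h5.2, h6.1, h6.2]

end Kernel

/-! ### Lebesgue points, control of the first variation, and the limit. -/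

section Convergence

open scoped ENNReal

variable {d n : ℕ} {Ω M : Set (Euc n)} {θ : Euc n → ℝ} {V : Measure (Euc n × Grass d n)}

/-- The mean of `‖G‖` with respect to `m` over balls about `x`, normalized by `μ`, tends to `0`. -/
def HasVanishingMeanAt (m μ : Measure (Euc n)) (G : Euc n → Euc n) (x : Euc n) : Prop :=
  Tendsto (fun r => (∫⁻ y in Metric.closedBall x r, ‖G y‖ₑ ∂m) / μ (Metric.closedBall x r))
    (𝓝[>] 0) (𝓝 0)

theorem HasVanishingMeanAt.eventually_le {m μ : Measure (Euc n)} {G : Euc n → Euc n} {x : Euc n}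
    (h : HasVanishingMeanAt m μ G x) : ∀ᶠ r in 𝓝[>] (0 : ℝ),
      ∫⁻ y in Metric.closedBall x r, ‖G y‖ₑ ∂m ≤ μ (Metric.closedBall x r) := by
  filter_upwards [h.eventually (gt_mem_nhds (zero_lt_one' ℝ≥0∞))] with r hr
  by_contra hlt
  rw [not_le] at hlt
  refine absurd hr (not_lt.mpr ?_)
  -- In `ℝ≥0∞` a nonzero number divided by `0` is `⊤`, so a quotient below `1` also settles balls of
  -- measure zero.
  rcases eq_or_ne (μ (Metric.closedBall x r)) 0 with h0 | h0
  · rw [h0] at hlt ⊢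
    rw [ENNReal.div_zero hlt.ne']
    exact le_top
  · rw [ENNReal.le_div_iff_mul_le (Or.inl h0) (Or.inl hlt.ne_top), one_mul]
    exact hlt.le

/-- The integral is at most `sup |k|` times the vanishing mean times `μ` of the closed `ε`-ball, and
the density keeps `ε⁻ᵈ μ` of that ball bounded. The density concerns open balls, so the radius is
doubled, whence the factor `2ᵈ`. -/
theorem HasVanishingMeanAt.tendsto_integral {m μ : Measure (Euc n)} {G : Euc n → Euc n} {x : Euc n}
    (h : HasVanishingMeanAt m μ G x) {R Θ : ℝ} (hR : 0 < R) (hfin : μ (Metric.ball x R) ≠ ⊤)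
    (hΘ : Tendsto (fun r => (r ^ d)⁻¹ * μ.real (Metric.ball x r)) (𝓝[>] 0) (𝓝 Θ))
    {k : ℝ → ℝ} (hk : Continuous k) (hs : tsupport k ⊆ Icc (-1) 1) {g : Euc n → ℝ}
    (hg : ∀ y, |g y| ≤ ‖G y‖) :
    Tendsto (fun ε => (ε ^ d)⁻¹ * ∫ y, k (‖y - x‖ / ε) * g y ∂m) (𝓝[>] 0) (𝓝 0) := by
  have hone : ∀ t, 1 ≤ t → k t = 0 := fun t => eq_zero_of_one_le hk hs
  have hcs : HasCompactSupport k := isCompact_Icc.of_isClosed_subset (isClosed_tsupport _) hs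
  obtain ⟨B, hB⟩ := hcs.exists_bound_of_continuous hk
  have hB0 : 0 ≤ B := (norm_nonneg _).trans (hB 0)
  set I : ℝ → ℝ≥0∞ := fun r => ∫⁻ y in Metric.closedBall x r, ‖G y‖ₑ ∂m with hI
  have hq : Tendsto (fun r => (I r / μ (Metric.closedBall x r)).toReal) (𝓝[>] 0) (𝓝 0) := by
    have := (ENNReal.tendsto_toReal ENNReal.zero_ne_top).comp h
    rwa [ENNReal.toReal_zero] at this
  have h2 := tendsto_const_mul_nhdsGT_zero two_pos
  have hlim := (hq.const_mul B).mul ((hΘ.comp h2).const_mul ((2 : ℝ) ^ d))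
  rw [mul_zero, zero_mul] at hlim
  refine squeeze_zero_norm' ?_ hlim
  filter_upwards [h.eventually_le, Ioo_mem_nhdsGT (show 0 < R / 2 by positivity)] with ε hle hε
  have hε0 : 0 < ε := hε.1
  have hball : Metric.closedBall x ε ⊆ Metric.ball x (2 * ε) :=
    Metric.closedBall_subset_ball (by linarith)
  have hbfin : μ (Metric.ball x (2 * ε)) ≠ ⊤ := ((measure_mono (Metric.ball_subset_ball
    (by linarith [hε.2]))).trans_lt hfin.lt_top).ne
  have hcfin : μ (Metric.closedBall x ε) ≠ ⊤ := ((measure_mono hball).trans_lt hbfin.lt_top).ne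
  have hIfin : I ε ≠ ⊤ := (hle.trans_lt hcfin.lt_top).ne
  have hIq : (I ε).toReal =
      (I ε / μ (Metric.closedBall x ε)).toReal * μ.real (Metric.closedBall x ε) := by
    rw [measureReal_def, ← ENNReal.toReal_mul]
    rcases eq_or_ne (μ (Metric.closedBall x ε)) 0 with h0 | h0
    · have : I ε = 0 := by
        rw [h0] at hle
        exact le_antisymm hle zero_le
      simp [this]
    · rw [ENNReal.div_mul_cancel h0 hcfin]
  have hint : ‖∫ y, k (‖y - x‖ / ε) * g y ∂m‖ ≤ B * (I ε).toReal := by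
    have h3 : ‖∫ y, k (‖y - x‖ / ε) * g y ∂m‖ₑ ≤ ENNReal.ofReal B * I ε := by
      refine (enorm_integral_le_lintegral_enorm _).trans ?_
      rw [hI, ← lintegral_const_mul' _ _ ENNReal.ofReal_ne_top,
        ← lintegral_indicator Metric.isClosed_closedBall.measurableSet]
      refine lintegral_mono fun y => ?_
      by_cases hy : y ∈ Metric.closedBall x ε
      · rw [indicator_of_mem hy, enorm_mul]
        refine mul_le_mul' ?_ ?_
        · rw [← ofReal_norm]
          exact ENNReal.ofReal_le_ofReal (hB _)
        · rw [enorm_le_iff_norm_le]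
          exact hg y
      · rw [indicator_of_notMem hy, hone]
        · simp
        · rw [Metric.mem_closedBall, not_le, dist_eq_norm] at hy
          rw [one_le_div hε0]
          exact hy.le
    have h4 := ENNReal.toReal_mono (ENNReal.mul_ne_top ENNReal.ofReal_ne_top hIfin) h3
    rwa [ENNReal.toReal_mul, ENNReal.toReal_ofReal hB0, toReal_enorm] at h4
  have hmono : μ.real (Metric.closedBall x ε) ≤ μ.real (Metric.ball x (2 * ε)) :=
    measureReal_mono hball hbfin
  rw [norm_mul, Real.norm_of_nonneg (by positivity : 0 ≤ (ε ^ d)⁻¹)]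
  calc (ε ^ d)⁻¹ * ‖∫ y, k (‖y - x‖ / ε) * g y ∂m‖
      ≤ (ε ^ d)⁻¹ * (B * ((I ε / μ (Metric.closedBall x ε)).toReal *
          μ.real (Metric.ball x (2 * ε)))) := by
        rw [hIq] at hint
        gcongr
        exact hint.trans (by gcongr)
    _ = _ := by
        simp only [Function.comp_apply, mul_pow]
        field_simp

theorem enorm_integral_inner_le {μ : Measure (Euc n)} {B : Set (Euc n)}
    {H X : Euc n → Euc n} (hH : IntegrableOn H B μ) (hX : Continuous X)
    (hXB : ∀ y, y ∉ B → X y = 0) :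
    ‖∫ y, ⟪X y, H y⟫ ∂μ‖ₑ ≤ ∫⁻ y, ‖X y‖ₑ ∂(μ.restrict B).withDensity fun y => ‖H y‖ₑ := by
  rw [lintegral_withDensity_eq_lintegral_mul₀ hH.1.enorm hX.enorm.measurable.aemeasurable]
  refine (enorm_integral_le_lintegral_enorm _).trans ?_
  rw [← setLIntegral_eq_of_support_subset (s := B) (Function.support_subset_iff'.mpr
    fun y hy => by simp [hXB y hy])]
  refine lintegral_mono fun y => ?_
  rw [Pi.mul_apply, mul_comm, ← ofReal_norm, ← ofReal_norm, ← ofReal_norm,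
    ← ENNReal.ofReal_mul (norm_nonneg _)]
  exact ENNReal.ofReal_le_ofReal (norm_inner_le_norm _ _)

/-- The decomposition of the first variation into mean curvature and singular part. -/
structure IsFirstVariationDecomposition (Ω : Set (Euc n)) (V : Measure (Euc n × Grass d n))
    (H : Euc n → Euc n) (ν : Measure (Euc n)) (σ : Euc n → Euc n) : Prop where
  integrableOn : ∀ K : Set (Euc n), IsCompact K → K ⊆ Ω → IntegrableOn H K (varifoldMass V)
  finite_on_compacts : ∀ K : Set (Euc n), IsCompact K → K ⊆ Ω → ν K < ⊤ ∧ IntegrableOn σ K ν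
  singular : ν ⟂ₘ varifoldMass V
  eq_integral : ∀ X : Euc n → Euc n, IsTestField Ω X →
    firstVariation V X = -∫ x, ⟪X x, H x⟫ ∂(varifoldMass V) + ∫ x, ⟪X x, σ x⟫ ∂ν

namespace IsFirstVariationDecomposition

variable {H σ : Euc n → Euc n} {ν : Measure (Euc n)} {x : Euc n}

/-- The controlling measure is `|H|‖V‖ + |σ|ν` near `x`. The constant is `2 + |H(x)|`: one unit for
`|H - H(x)|`, one for the singular part, and `|H(x)|` for the constant term. -/
theorem exists_controlled (hΩ : IsOpen Ω) (hV : IsVarifold Ω V)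
    (hdec : IsFirstVariationDecomposition Ω V H ν σ) (hx : x ∈ Ω)
    (hH : HasVanishingMeanAt (varifoldMass V) (varifoldMass V) (fun y => H y - H x) x)
    (hσ : HasVanishingMeanAt ν (varifoldMass V) σ x) :
    ∃ R C β, IsFirstVariationControlledAt V Ω x R C β := by
  obtain ⟨R₁, hR₁, hsub₁⟩ := Metric.nhds_basis_closedBall.mem_iff.mp (hΩ.mem_nhds hx)
  obtain ⟨R₂, hR₂, hsub₂⟩ := mem_nhdsGT_iff_exists_Ioc_subset.mp
    (hH.eventually_le.and hσ.eventually_le)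
  have hR₂' : 0 < R₂ := hR₂
  set R := min R₁ R₂ with hRdef
  have hR : 0 < R := lt_min hR₁ hR₂'
  set B := Metric.closedBall x R with hBdef
  have hBc : IsCompact B := isCompact_closedBall x R
  have hBm : MeasurableSet B := hBc.measurableSet
  have hBΩ : B ⊆ Ω := (Metric.closedBall_subset_closedBall (min_le_left _ _)).trans hsub₁
  set m := varifoldMass V with hm
  set β₁ := (m.restrict B).withDensity fun y => ‖H y‖ₑ with hβ₁
  set β₂ := (ν.restrict B).withDensity fun y => ‖σ y‖ₑ with hβ₂
  have hHB := hdec.integrableOn B hBc hBΩ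
  have hσB := (hdec.finite_on_compacts B hBc hBΩ).2
  have hfin₁ : IsFiniteMeasure β₁ := isFiniteMeasure_withDensity hHB.2.ne
  have hfin₂ : IsFiniteMeasure β₂ := isFiniteMeasure_withDensity hσB.2.ne
  have happly (μ : Measure (Euc n)) (G : Euc n → Euc n) {a : ℝ} (ha : a ≤ R) :
      ((μ.restrict B).withDensity fun y => ‖G y‖ₑ) (Metric.closedBall x a) =
        ∫⁻ y in Metric.closedBall x a, ‖G y‖ₑ ∂μ := by
    rw [withDensity_apply _ Metric.isClosed_closedBall.measurableSet,
      Measure.restrict_restrict Metric.isClosed_closedBall.measurableSet,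
      inter_eq_left.mpr (Metric.closedBall_subset_closedBall ha)]
  have hpos (a : ℝ) (ha : 0 < a) (haR : a ≤ R) : (β₁ + β₂) (Metric.closedBall x a) ≤
      ENNReal.ofReal (2 + ‖H x‖) * m (Metric.closedBall x a) := by
    have h := hsub₂ ⟨ha, haR.trans (min_le_right _ _)⟩
    rw [Measure.add_apply, hβ₁, hβ₂, happly _ _ haR, happly _ _ haR]
    have h1 : ∫⁻ y in Metric.closedBall x a, ‖H y‖ₑ ∂m ≤
        m (Metric.closedBall x a) + ‖H x‖ₑ * m (Metric.closedBall x a) := by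
      calc _ ≤ ∫⁻ y in Metric.closedBall x a, (‖H y - H x‖ₑ + ‖H x‖ₑ) ∂m := by
            refine lintegral_mono fun y => ?_
            simpa using enorm_add_le (H y - H x) (H x)
        _ = (∫⁻ y in Metric.closedBall x a, ‖H y - H x‖ₑ ∂m) +
            ‖H x‖ₑ * m (Metric.closedBall x a) := by
            rw [lintegral_add_right _ measurable_const]
            simp
        _ ≤ _ := by gcongr; exact h.1
    calc _ ≤ (m (Metric.closedBall x a) + ‖H x‖ₑ * m (Metric.closedBall x a)) +
          m (Metric.closedBall x a) := add_le_add h1 h.2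
      _ = _ := by
          rw [ENNReal.ofReal_add (by norm_num) (norm_nonneg _), ofReal_norm, ENNReal.ofReal_ofNat]
          ring
  refine ⟨R, 2 + ‖H x‖, β₁ + β₂, hR, by positivity, hBΩ, fun X hX hXB => ?_, fun a ha haR => ?_⟩
  · have hX0 (y : Euc n) (hy : y ∉ B) : X y = 0 :=
      image_eq_zero_of_notMem_tsupport fun h => hy (hXB h)
    have hXc := hX.contDiff.continuous
    rw [hdec.eq_integral X hX, ← Real.enorm_eq_ofReal_abs, lintegral_add_measure]
    refine (enorm_add_le _ _).trans ?_
    rw [enorm_neg]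
    exact add_le_add (enorm_integral_inner_le hHB hXc hX0)
      (enorm_integral_inner_le hσB hXc hX0)
  · rcases ha.eq_or_lt with rfl | ha
    -- The means control positive radii only; the singleton is reached as a decreasing limit of
    -- balls.
    · have hball (μ : Measure (Euc n)) (hμ : μ B ≠ ⊤) :
          Tendsto (fun r => μ (Metric.closedBall x r)) (𝓝[>] 0)
            (𝓝 (μ (Metric.closedBall x 0))) := by
        rw [Metric.closedBall_zero]
        have h1 := tendsto_measure_cthickening_of_isClosed (μ := μ) (s := {x})
          ⟨R, hR, by rwa [Metric.cthickening_singleton x hR.le]⟩ isClosed_singleton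
        refine (h1.mono_left nhdsWithin_le_nhds).congr' ?_
        filter_upwards [eventually_mem_nhdsWithin] with r hr
        rw [Metric.cthickening_singleton x (le_of_lt hr)]
      refine le_of_tendsto_of_tendsto (hball _ (measure_ne_top _ _))
        (ENNReal.Tendsto.const_mul (hball m (hV.mass_lt_top hBc hBΩ).ne)
          (Or.inr ENNReal.ofReal_ne_top)) ?_
      filter_upwards [Ioc_mem_nhdsGT hR] with r hr using hpos r hr.1 hr.2
    · exact hpos a ha haR

/-- Besicovitch differentiation on each compact piece: almost every point is a Lebesgue point of
`H`, and `|σ|ν`, being singular to `‖V‖`, has derivative zero almost everywhere. -/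
theorem ae_hasVanishingMeanAt (hΩ : IsOpen Ω) (hV : IsVarifold Ω V)
    (hdec : IsFirstVariationDecomposition Ω V H ν σ) :
    ∀ᵐ x ∂(varifoldMass V), x ∈ Ω →
      HasVanishingMeanAt (varifoldMass V) (varifoldMass V) (fun y => H y - H x) x ∧
      HasVanishingMeanAt ν (varifoldMass V) σ x := by
  obtain ⟨K, hK, hKΩ, hcov⟩ := exists_compact_exhaustion hΩ
  set m := varifoldMass V with hm
  have key (j : ℕ) : ∀ᵐ x ∂m, x ∈ interior (K j) →
      HasVanishingMeanAt m m (fun y => H y - H x) x ∧ HasVanishingMeanAt ν m σ x := by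
    have hKm := (hK j).measurableSet
    have hfin : IsFiniteMeasure (m.restrict (K j)) :=
      ⟨by simpa using hV.mass_lt_top (hK j) (hKΩ j)⟩
    have hHK := hdec.integrableOn _ (hK j) (hKΩ j)
    have hσK := (hdec.finite_on_compacts _ (hK j) (hKΩ j)).2
    set β := (ν.restrict (K j)).withDensity fun y => ‖σ y‖ₑ with hβ
    have hfinβ : IsFiniteMeasure β := isFiniteMeasure_withDensity hσK.2.ne
    have hsing : β ⟂ₘ m.restrict (K j) :=
      (hdec.singular.mono_ac ((withDensity_absolutelyContinuous _ _).trans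
        Measure.restrict_le_self.absolutelyContinuous)
        Measure.restrict_le_self.absolutelyContinuous)
    have h1 := (Besicovitch.vitaliFamily (m.restrict (K j))).ae_tendsto_lintegral_enorm_sub_div
      hHK.locallyIntegrable
    have h2 := Besicovitch.ae_tendsto_rnDeriv β (m.restrict (K j))
    have h3 : β.rnDeriv (m.restrict (K j)) =ᵐ[m.restrict (K j)] 0 :=
      have := hsing.haveLebesgueDecomposition
      (Measure.rnDeriv_eq_zero β _).mpr hsing
    have h4 : ∀ᵐ x ∂m.restrict (K j), x ∈ interior (K j) →
        HasVanishingMeanAt m m (fun y => H y - H x) x ∧ HasVanishingMeanAt ν m σ x := by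
      filter_upwards [h1, h2, h3] with x hx1 hx2 hx3 hxK
      rw [hx3] at hx2
      obtain ⟨R, hR, hsub⟩ := Metric.nhds_basis_closedBall.mem_iff.mp
        (mem_interior_iff_mem_nhds.mp hxK)
      have hrest (μ : Measure (Euc n)) {r : ℝ} (hr : r ≤ R) :
          (μ.restrict (K j)).restrict (Metric.closedBall x r) =
            μ.restrict (Metric.closedBall x r) := by
        rw [Measure.restrict_restrict Metric.isClosed_closedBall.measurableSet,
          inter_eq_left.mpr ((Metric.closedBall_subset_closedBall hr).trans hsub)]
      have hmeas {r : ℝ} (hr : r ≤ R) :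
          m.restrict (K j) (Metric.closedBall x r) = m (Metric.closedBall x r) := by
        rw [← Measure.restrict_apply_univ (Metric.closedBall x r), hrest m hr,
          Measure.restrict_apply_univ]
      constructor
      · refine (hx1.comp (Besicovitch.tendsto_filterAt _ x)).congr' ?_
        filter_upwards [Ioc_mem_nhdsGT hR] with r hr
        simp only [Function.comp_apply]
        rw [hrest m hr.2, hmeas hr.2]
      · refine hx2.congr' ?_
        filter_upwards [Ioc_mem_nhdsGT hR] with r hr
        rw [hmeas hr.2, hβ, withDensity_apply _ Metric.isClosed_closedBall.measurableSet,
          hrest ν hr.2]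
    rw [ae_restrict_iff' hKm] at h4
    filter_upwards [h4] with x hx hxK using hx (interior_subset hxK) hxK
  filter_upwards [ae_all_iff.mpr key] with x hx hxΩ
  obtain ⟨j, hj⟩ := mem_iUnion.mp (hcov hxΩ)
  exact hx j hj

end IsFirstVariationDecomposition

theorem scaledKernel_sub_eq (k : ℝ → ℝ) {ε : ℝ} (hε : 0 < ε) (x y : Euc n) :
    scaledKernel k ε (x - y) = (ε ^ n)⁻¹ * k (‖y - x‖ / ε) := by
  rw [scaledKernel, norm_smul, norm_inv, Real.norm_of_nonneg hε.le, norm_sub_rev, div_eq_inv_mul]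

theorem isTestFunction_scaledKernel {k : ℝ → ℝ} (hk : ContDiff ℝ 1 k) (heven : ∀ t, k (-t) = k t)
    (hs : tsupport k ⊆ Icc (-1) 1) {ε : ℝ} (hε : 0 < ε) {x : Euc n}
    (hΩ : Metric.closedBall x ε ⊆ Ω) : IsTestFunction Ω fun y => scaledKernel k ε (x - y) := by
  have h : tsupport (fun y => scaledKernel k ε (x - y)) ⊆ Metric.closedBall x ε := by
    refine closure_minimal (fun y hy => ?_) Metric.isClosed_closedBall
    by_contra hn
    rw [Metric.mem_closedBall, not_le, dist_eq_norm] at hn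
    refine hy ?_
    simp only
    rw [scaledKernel_sub_eq k hε, eq_zero_of_one_le hk.continuous hs, mul_zero]
    rw [one_le_div hε]
    exact hn.le
  refine ⟨?_, (isCompact_closedBall x ε).of_isClosed_subset (isClosed_tsupport _) h, h.trans hΩ⟩
  exact contDiff_const.mul ((contDiff_comp_norm_of_even hk heven).comp
    ((contDiff_const (c := x)).sub contDiff_id |>.const_smul ε⁻¹))

/-- Numerator and denominator share the factor `ε^(d-n)`. Without it they tend to `-c C_ρ H(x)` and
`c C_ξ`, where `c = Θ/ω_d > 0`. -/
theorem tendsto_approxMeanCurvature_of_density (hd : 1 ≤ d) (hV : IsVarifold Ω V)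
    {ρ ξ : ℝ → ℝ} (hρ : IsKernelProfile n ρ) (hρ_smooth : ContDiff ℝ 1 ρ)
    (hξ : IsKernelProfile n ξ) (hξ_cont : Continuous ξ) {H σ : Euc n → Euc n}
    {ν : Measure (Euc n)} (hdec : IsFirstVariationDecomposition Ω V H ν σ) {x : Euc n}
    (hH : HasVanishingMeanAt (varifoldMass V) (varifoldMass V) (fun y => H y - H x) x)
    (hσ : HasVanishingMeanAt ν (varifoldMass V) σ x) {R Θ : ℝ} (hR : 0 < R)
    (hRΩ : Metric.closedBall x R ⊆ Ω) (hΘ0 : 0 < Θ)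
    (hΘ : Tendsto (fun r => (r ^ d)⁻¹ * (varifoldMass V).real (Metric.ball x r)) (𝓝[>] 0) (𝓝 Θ)) :
    (∀ᶠ ε in 𝓝[>] (0 : ℝ), 0 < regularizedMass V ξ ε x) ∧
      Tendsto (fun ε : ℝ => approxMeanCurvature V ρ ξ ε x) (𝓝[>] 0) (𝓝 (H x)) := by
  have : Nonempty (Fin d) := ⟨⟨0, hd⟩⟩
  set m := varifoldMass V with hm
  set c := Θ / (volume : Measure (Euc d)).real (Metric.ball 0 1) with hc
  have hc0 : 0 < c := div_pos hΘ0 (ENNReal.toReal_pos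
    (Metric.measure_ball_pos _ _ one_pos).ne' measure_ball_lt_top.ne)
  have hCρ := kernelConst_pos hρ_smooth.continuous hρ hd
  have hCξ := kernelConst_pos hξ_cont hξ hd
  have hfin : m (Metric.ball x R) ≠ ⊤ := ((measure_mono Metric.ball_subset_closedBall).trans_lt
    (hV.mass_lt_top (isCompact_closedBall x R) hRΩ)).ne
  set F : (ℝ → ℝ) → ℝ → ℝ := fun k ε => (ε ^ d)⁻¹ * ∫ y, k (‖y - x‖ / ε) ∂m with hF
  have hFξ : Tendsto (F ξ) (𝓝[>] 0) (𝓝 (c * kernelConst d ξ)) :=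
    tendsto_integral_radial hd hR hfin hΘ hξ_cont hξ.tsupport_subset
  have hFρ : Tendsto (F ρ) (𝓝[>] 0) (𝓝 (c * kernelConst d ρ)) :=
    tendsto_integral_radial hd hR hfin hΘ hρ_smooth.continuous hρ.tsupport_subset
  have hmass (ε : ℝ) (hε : 0 < ε) : regularizedMass V ξ ε x = (ε ^ n)⁻¹ * ε ^ d * F ξ ε := by
    simp only [regularizedMass, scaledKernel_sub_eq ξ hε, hF]
    rw [integral_const_mul, ← hm]
    field_simp
  -- The rescaled `i`-th coordinate of `δV ∗ ρ_ε`, with `H` split as `H(x) + (H - H(x))`; the last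
  -- two terms vanish in the limit.
  set A : Fin n → ℝ → ℝ := fun i ε =>
    -(F ρ ε * H x i) - (ε ^ d)⁻¹ * ∫ y, ρ (‖y - x‖ / ε) * (H y - H x) i ∂m +
      (ε ^ d)⁻¹ * ∫ y, ρ (‖y - x‖ / ε) * σ y i ∂ν with hA
  have hAlim (i : Fin n) : Tendsto (A i) (𝓝[>] 0) (𝓝 (-(c * kernelConst d ρ * H x i))) := by
    have h1 := hH.tendsto_integral hR hfin hΘ hρ_smooth.continuous hρ.tsupport_subset
      (g := fun y => (H y - H x) i) fun y => PiLp.norm_apply_le (H y - H x) i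
    have h2 := hσ.tendsto_integral hR hfin hΘ hρ_smooth.continuous hρ.tsupport_subset
      (g := fun y => σ y i) fun y => PiLp.norm_apply_le (σ y) i
    have h3 := ((hFρ.mul_const (H x i)).neg.sub h1).add h2
    rwa [sub_zero, add_zero] at h3
  have hfirst (ε : ℝ) (hε : 0 < ε) (hεR : ε ≤ R) : regularizedFirstVariation V ρ ε x =
      ((ε ^ n)⁻¹ * ε ^ d) • (WithLp.toLp 2 fun i => A i ε : Euc n) := by
    have hball := (Metric.closedBall_subset_closedBall hεR).trans hRΩ
    have htest := isTestFunction_scaledKernel hρ_smooth hρ.even hρ.tsupport_subset hε hball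
    ext i
    have hcc := htest.isCcOn
    have hHi : IntegrableOn (fun y => H y i) (tsupport fun y => scaledKernel ρ ε (x - y)) m :=
      (EuclideanSpace.proj i : Euc n →L[ℝ] ℝ).integrable_comp (hdec.integrableOn _ hcc.2 hcc.3)
    have hconst : IntegrableOn (fun _ => H x i) (tsupport fun y => scaledKernel ρ ε (x - y)) m :=
      integrableOn_const (hV.mass_lt_top hcc.2 hcc.3).ne
    have hsplit : ∫ y, scaledKernel ρ ε (x - y) * H y i ∂m =
        ∫ y, scaledKernel ρ ε (x - y) * (H y - H x) i ∂m +
          (∫ y, scaledKernel ρ ε (x - y) ∂m) * H x i := by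
      have h1 : Integrable (fun y => scaledKernel ρ ε (x - y) * (H y - H x) i) m :=
        hcc.integrable_mul (hHi.sub hconst)
      rw [← integral_mul_const, ← integral_add h1 (hcc.integrable_mul hconst)]
      refine integral_congr_ae (ae_of_all _ fun y => ?_)
      simp only [PiLp.sub_apply]
      ring
    change firstVariation V _ = _
    rw [hdec.eq_integral _ (htest.smul_single i)]
    simp only [real_inner_smul_left, EuclideanSpace.inner_single_left, map_one, one_mul]
    rw [← hm, hsplit]
    simp only [scaledKernel_sub_eq ρ hε, mul_assoc, integral_const_mul, hA, hF, PiLp.smul_apply,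
      smul_eq_mul]
    field_simp
    ring
  have hpos : ∀ᶠ ε in 𝓝[>] (0 : ℝ), 0 < F ξ ε :=
    hFξ.eventually (lt_mem_nhds (mul_pos hc0 hCξ))
  refine ⟨?_, ?_⟩
  · filter_upwards [hpos, eventually_mem_nhdsWithin] with ε h1 hε
    rw [hmass ε hε]
    have : (0 : ℝ) < ε := hε
    positivity
  · have hvec : Tendsto (fun ε => (WithLp.toLp 2 fun i => A i ε : Euc n)) (𝓝[>] 0)
        (𝓝 (WithLp.toLp 2 fun i => -(c * kernelConst d ρ * H x i))) :=
      ((PiLp.continuous_toLp 2 _).tendsto _).comp (tendsto_pi_nhds.mpr hAlim)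
    have hlim := (((hFξ.inv₀ (mul_pos hc0 hCξ).ne').smul hvec).const_smul
      (kernelConst d ξ / kernelConst d ρ)).neg
    have heq : -((kernelConst d ξ / kernelConst d ρ) • (c * kernelConst d ξ)⁻¹ •
        (WithLp.toLp 2 fun i => -(c * kernelConst d ρ * H x i) : Euc n)) = H x := by
      ext i
      simp only [PiLp.neg_apply, PiLp.smul_apply, smul_eq_mul]
      field_simp
    rw [heq] at hlim
    refine hlim.congr' ?_
    filter_upwards [Ioc_mem_nhdsGT hR, hpos] with ε hε hFpos
    have hε0 : 0 < ε := hε.1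
    rw [approxMeanCurvature, hmass ε hε0, hfirst ε hε0 hε.2, smul_smul _ ((ε ^ n)⁻¹ * ε ^ d)]
    congr 3
    field_simp

end Convergence

/-! ### The main theorem. -/

theorem theorem4p2 {d n : ℕ} (hd : 1 ≤ d) (hdn : d < n)
    (ρ ξ : ℝ → ℝ) (hρ : IsKernelProfile n ρ) (hρ_smooth : ContDiff ℝ 1 ρ)
    (hξ : IsKernelProfile n ξ) (hξ_cont : Continuous ξ)
    (Ω : Set (Euc n)) (hΩ : IsOpen Ω)
    (M : Set (Euc n)) (θ : Euc n → ℝ) (V : Measure (Euc n × Grass d n))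
    (hV : IsRectifiableVarifold Ω M θ V)
    (hδV : HasLocallyBoundedFirstVariation Ω V) :
    (∃ H : Euc n → Euc n, IsGeneralizedMeanCurvature Ω V H) ∧
    ∀ H : Euc n → Euc n, IsGeneralizedMeanCurvature Ω V H →
      ∀ᵐ x ∂(varifoldMass V),
        (∀ᶠ ε in 𝓝[>] (0 : ℝ), 0 < regularizedMass V ξ ε x) ∧
        Tendsto (fun ε : ℝ => approxMeanCurvature V ρ ξ ε x) (𝓝[>] 0) (𝓝 (H x)) := by
  refine ⟨exists_isGeneralizedMeanCurvature hΩ hV.isVarifold hδV, ?_⟩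
  rintro H ⟨hHint, ν, σ, -, hν, hsing, hrep⟩
  have hdec : IsFirstVariationDecomposition Ω V H ν σ := ⟨hHint, hν, hsing, hrep⟩
  have hmem : ∀ᵐ x ∂(varifoldMass V), x ∈ Ω := by
    rw [ae_iff]
    exact hV.isVarifold.mass_compl hΩ
  filter_upwards [hmem, hdec.ae_hasVanishingMeanAt hΩ hV.isVarifold,
    hV.ae_notMem_zeroDensitySet hΩ] with x hx hmean hdens
  obtain ⟨hH, hσ⟩ := hmean hx
  obtain ⟨R, C, β, hctrl⟩ := hdec.exists_controlled hΩ hV.isVarifold hx hH hσ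
  obtain ⟨Θ, hΘ0, hΘ⟩ := hctrl.exists_tendsto_density hV.isVarifold
  -- The density exists by monotonicity; were it zero, `x` would belong to the excluded null set.
  refine tendsto_approxMeanCurvature_of_density hd hV.isVarifold hρ hρ_smooth hξ hξ_cont hdec hH hσ
    hctrl.pos hctrl.closedBall_subset (hΘ0.lt_of_ne' fun h0 => hdens ?_) hΘ
  rw [h0] at hΘ
  exact mem_zeroDensitySet_of_tendsto
    ((hV.isVarifold.mass_lt_top (isCompact_closedBall x R) hctrl.closedBall_subset).ne)
    hctrl.pos hΘ
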